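/- **Setting.** Let $\mathcal X\subset(0,\infty)$ be a nonempty compact set of difficulty levels, let $0<\underline p<\overline p<\infty$, and let $h:(0,\infty)^2\to(0,1)$ be continuously differentiable, with $h(x,p)$ strictly decreasing in $x$ and strictly increasing in $p$. Let $0=u_0<u_1<\dots<u_J<u_{J+1}=\infty$ be grade boundaries; grade $i\in\{0,\dots,J\}$ corresponds to the bracket $[u_i,u_{i+1})$. A candidate has an unknown ability $p\in(\underline p,\overline p)$. An algorithm asks questions $X_1,X_2,\ldots\in\mathcal X$ sequentially, where the law of $X_{t+1}$ given the past depends only on $\mathcal F_t=\sigma(X_k,I_k:k\le t)$ and not on $p$; given $\mathcal F_{t-1}$ and $X_t$, the response $I_t\in\{0,1\}$ is Bernoulli with mean $h(X_t,p)$. The algorithm stops after $\tau$ questions, where $\tau$ is a stopping time of $(\mathcal F_t)_{t\ge 0}$, and announces an $\mathcal F_\tau$-measurable grade. Write $P_p$, $E_p$ for probability and expectation when the ability is $p$. The algorithm is $\delta$-correct if, for every grade $i$ and every $p\in(u_i,u_{i+1})\cap(\underline p,\overline p)$, $E_p[\tau]<\infty$ and $P_p(\text{announced grade}\ne i)\le\delta$.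 For $q,r\in(0,1)$ let $d(q|r)=q\log\frac qr+(1-q)\log\frac{1-q}{1-r}$. Fix $i$ and $p\in(u_i,u_{i+1})\cap(\underline p,\overline p)$. Let $m^*$ be the optimal value of the variational problem of minimizing $m(\mathcal X)$ over finite Borel measures $m$ on $\mathcal X$ such that $$\inf_{u\in(\underline p,\overline p)\setminus[u_i,u_{i+1})}\int_{\mathcal X} d\big(h(x,p)\,|\,h(x,u)\big)\,dm(x)\ \ge\ 1 .$$ Let $f_1(x)=d(h(x,p)|h(x,u_i))$ if $u_i>\underline p$, and $f_1\equiv+\infty$ otherwise (no admissible ability lies below $u_i$; in particular for $i=0$). Let $f_2(x)=d(h(x,p)|h(x,u_{i+1}))$ if $u_{i+1}<\overline p$, and $f_2\equiv+\infty$ otherwise (in particular for $i=J$). Use the conventions $0\cdot\infty=0$, $1/\infty=0$, and $\inf\emptyset=+\infty$. **Theorem (lower bound, primal and dual formulation).** 1. For every $\delta$ with $0<\delta<1/2.4$ and every $\delta$-correct algorithm, $$\frac{E_p[\tau]}{\log\frac1{2.4\,\delta}}\ \ge\ m^* .$$ 2. (Primal formulation; the maximum is attained.) $$m^*=\Big[\max_{w\in[0,1],\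 x_1,x_2\in\mathcal X}\ \min_{j=1,2}\big(w f_j(x_1)+(1-w)f_j(x_2)\big)\Big]^{-1}.$$ 3. (At most two levels suffice.) The variational problem defining $m^*$ has an optimal solution of the form $c_1\delta_{x_1}+c_2\delta_{x_2}$, where $x_1,x_2\in\mathcal X$, $c_1,c_2\in[0,\infty)$, and $\delta_x$ denotes the unit mass at $x$. 4. (Dual formulation.) $$m^*=\Big[\inf_{\lambda\in[0,1]}\ \sup_{x\in\mathcal X}\big(\lambda f_1(x)+(1-\lambda)f_2(x)\big)\Big]^{-1}.$$ -/

import Mathlib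

open Set MeasureTheory ProbabilityTheory
open scoped ENNReal NNReal

noncomputable section

/-- Kullback-Leibler divergence between the Bernoulli distributions with means `q` and `r`
(used only for `q, r ∈ (0, 1)`). -/
def klBer (q r : ℝ) : ℝ :=
  q * Real.log (q / r) + (1 - q) * Real.log ((1 - q) / (1 - r))

/-- The data of the grading problem, with the standing regularity assumptions on the set of
difficulty levels and on the response function. -/
structure GradingProblem where
  /-- the set of available difficulty levels -/
  levels : Set ℝ
  /-- the response function: `h x p` is the probability that a candidate of ability `p`
  answers a question of difficulty `x` correctly -/
  h : ℝ → ℝ → ℝ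
  /-- candidates' abilities lie in the open interval `(pmin, pmax)` -/
  pmin : ℝ
  pmax : ℝ
  /-- there are the `J + 1` grades `0, …, J` -/
  J : ℕ
  /-- the grade boundaries `0 = u 0 < u 1 < … < u J < u (J + 1) = ∞` -/
  u : Fin (J + 2) → EReal
  levels_nonempty : levels.Nonempty
  levels_compact : IsCompact levels
  levels_pos : ∀ x ∈ levels, 0 < x
  pmin_pos : 0 < pmin
  pmin_lt_pmax : pmin < pmax
  u_zero : u 0 = 0
  u_last : u (Fin.last (J + 1)) = ⊤
  u_strictMono : StrictMono u
  h_mem : ∀ x p, 0 < x → 0 < p → h x p ∈ Ioo (0 : ℝ) 1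
  h_strictAnti : ∀ p, 0 < p → StrictAntiOn (fun x => h x p) (Ioi 0)
  h_strictMono : ∀ x, 0 < x → StrictMonoOn (fun p => h x p) (Ioi 0)
  h_contDiff : ContDiffOn ℝ 1 (fun z : ℝ × ℝ => h z.1 z.2) (Ioi 0 ×ˢ Ioi 0)

namespace GradingProblem

variable (S : GradingProblem)

/-- The admissible abilities, `(pmin, pmax)`. -/
def abilities : Set ℝ := Ioo S.pmin S.pmax

/-- The grade bracket `[u i, u (i + 1))`. -/
def bracket (i : Fin (S.J + 1)) : Set ℝ :=
  {p | S.u i.castSucc ≤ (p : EReal) ∧ (p : EReal) < S.u i.succ}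

/-- The open grade bracket `(u i, u (i + 1))`. -/
def openBracket (i : Fin (S.J + 1)) : Set ℝ :=
  {p | S.u i.castSucc < (p : EReal) ∧ (p : EReal) < S.u i.succ}

lemma ability_pos (p : S.abilities) : 0 < (p : ℝ) := S.pmin_pos.trans p.2.1

lemma h_mem_unitInterval (p : S.abilities) (x : S.levels) : S.h x p ∈ unitInterval :=
  Ioo_subset_Icc_self (S.h_mem x p (S.levels_pos x x.2) (S.ability_pos p))

lemma measurable_h (p : S.abilities) : Measurable fun x : S.levels => S.h x p := by
  have hc : Continuous fun x : S.levels => S.h x p :=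
    S.h_contDiff.continuousOn.comp_continuous (f := fun x : S.levels => ((x : ℝ), (p : ℝ)))
      (by fun_prop) fun x => ⟨S.levels_pos x x.2, S.ability_pos p⟩
  exact hc.measurable

/-- The law of the response of a candidate of ability `p` to a question of difficulty `x`:
`true` (a correct answer) with probability `h x p`, else `false`. -/
def response (p : S.abilities) : Kernel S.levels Bool where
  toFun x := bernoulliMeasure true false ⟨S.h x p, S.h_mem_unitInterval p x⟩
  measurable' := by
    refine Measure.measurable_of_measurable_coe _ fun s hs => ?_
    classical
    have hm : Measurable fun x : S.levels =>
        (⟨S.h x p, S.h_mem_unitInterval p x⟩ : unitInterval) :=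
      (S.measurable_h p).subtype_mk
    have h1 : Measurable fun t : unitInterval => (unitInterval.toNNReal t : ℝ≥0∞) :=
      (show Measurable fun t : unitInterval => (unitInterval.toNNReal t) from
        (measurable_subtype_coe.subtype_mk)).coe_nnreal_ennreal
    have h2 : Measurable fun t : unitInterval =>
        (unitInterval.toNNReal (unitInterval.symm t) : ℝ≥0∞) :=
      h1.comp unitInterval.continuous_symm.measurable
    simp_rw [bernoulliMeasure_apply _ hs]
    split_ifs
    · exact measurable_const
    · exact h1.comp hm
    · exact h2.comp hm
    · exact measurable_const

instance (p : S.abilities) : IsMarkovKernel (S.response p) :=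
  ⟨fun x => by dsimp [response]; infer_instance⟩

/-- One round: the difficulty level of the question that is asked, and the response to it. -/
abbrev Round : Type := S.levels × Bool

/-- Infinite sequences of rounds; coordinate `n` holds `(X_{n+1}, I_{n+1})`. -/
abbrev Path : Type := ℕ → S.Round

/-- The filtration of the observations: `S.observed t` is generated by the first `t` questions
and responses. -/
def observed : Filtration ℕ (inferInstance : MeasurableSpace S.Path) where
  seq t := MeasurableSpace.comap (fun (ω : S.Path) (s : Fin t) => ω s) inferInstance
  mono' := by
    intro a b hab
    have hg : Measurable fun (v : Fin b → S.Round) (s : Fin a) => v (Fin.castLE hab s) := by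
      fun_prop
    change MeasurableSpace.comap
      ((fun (v : Fin b → S.Round) (s : Fin a) => v (Fin.castLE hab s)) ∘
        fun (ω : S.Path) (s : Fin b) => ω s) inferInstance ≤ _
    rw [← MeasurableSpace.comap_comp]
    exact MeasurableSpace.comap_mono hg.comap_le
  le' t := Measurable.comap_le (by fun_prop)

/-- A (possibly randomizing) sequential grading algorithm: the law of the first question, the
law of each further question given the past questions and responses, the number of questions
asked, a stopping time of the observations, and the announced grade, which is determined by
the observations up to that time. None of these may depend on the candidate's ability. -/
structure Algorithm where
  first : Measure S.levels
  first_prob : IsProbabilityMeasure first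
  next : (n : ℕ) → Kernel (Finset.Iic n → S.Round) S.levels
  next_markov : ∀ n, IsMarkovKernel (next n)
  τ : S.Path → ℕ∞
  isStoppingTime : IsStoppingTime S.observed τ
  grade : S.Path → Fin (S.J + 1)
  grade_measurable : Measurable[isStoppingTime.measurableSpace] grade

attribute [instance] Algorithm.first_prob Algorithm.next_markov

variable {S}

/-- The law of the questions and responses when `A` questions a candidate of ability `p`. -/
def Algorithm.law (A : S.Algorithm) (p : S.abilities) : Measure S.Path :=
  Kernel.trajMeasure (X := fun _ => S.Round) (A.first ⊗ₘ S.response p)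
    (fun n => A.next n ⊗ₖ (S.response p).prodMkLeft (Finset.Iic n → S.Round))

/-- The expected number of questions that `A` asks a candidate of ability `p`. -/
def Algorithm.expectedQuestions (A : S.Algorithm) (p : S.abilities) : ℝ≥0∞ :=
  ∫⁻ ω, (A.τ ω : ℝ≥0∞) ∂A.law p

/-- `δ`-correctness: for every admissible ability in the interior of a grade bracket, the expected
number of questions is finite and a wrong grade is announced with probability at most `δ`. -/
def Algorithm.IsDeltaCorrect (A : S.Algorithm) (δ : ℝ) : Prop :=
  ∀ (i : Fin (S.J + 1)) (p : S.abilities), (p : ℝ) ∈ S.openBracket i →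
    A.expectedQuestions p < ⊤ ∧ A.law p {ω | A.grade ω ≠ i} ≤ ENNReal.ofReal δ

variable (S)

/-- Feasibility for the variational problem at ability `p` in bracket `i`: a finite measure
(generalized distribution function) `m` on the set of levels such that
`inf_u ∫ d(h(x,p) | h(x,u)) dm(x) ≥ 1`, with `u` over the admissible abilities that lie outside
the bracket. -/
def Feasible (i : Fin (S.J + 1)) (p : S.abilities) (m : Measure S.levels) : Prop :=
  IsFiniteMeasure m ∧
    1 ≤ ⨅ u ∈ S.abilities \ S.bracket i,
      ∫⁻ x : S.levels, ENNReal.ofReal (klBer (S.h x p) (S.h x u)) ∂m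

/-- `m*`: the optimal value of the variational problem, the least total mass of a feasible
measure. -/
def mStar (i : Fin (S.J + 1)) (p : S.abilities) : ℝ≥0∞ :=
  ⨅ (m : Measure S.levels) (_ : S.Feasible i p m), m univ

open Classical in
/-- The divergence `d(h(x,p) | h(x,b))` to a grade boundary `b`. A boundary that lies outside the
range of admissible abilities (such as `0` or `∞`) separates `p` from no admissible ability, and
the divergence to it is `∞`. -/
def boundaryDiv (p : S.abilities) (b : EReal) (x : S.levels) : ℝ≥0∞ :=
  if (S.pmin : EReal) < b ∧ b < (S.pmax : EReal) then
    ENNReal.ofReal (klBer (S.h x p) (S.h x b.toReal))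
  else ⊤

/-- `f₁`, the divergence to the lower boundary of bracket `i`. -/
def f₁ (i : Fin (S.J + 1)) (p : S.abilities) : S.levels → ℝ≥0∞ :=
  S.boundaryDiv p (S.u i.castSucc)

/-- `f₂`, the divergence to the upper boundary of bracket `i`. -/
def f₂ (i : Fin (S.J + 1)) (p : S.abilities) : S.levels → ℝ≥0∞ :=
  S.boundaryDiv p (S.u i.succ)

/-- The objective of the primal (max-min) problem,
`min_j (w f_j(x₁) + (1 - w) f_j(x₂))`, with the convention `0 * ∞ = 0`. -/
def primalObjective (i : Fin (S.J + 1)) (p : S.abilities) (w : ℝ) (x₁ x₂ : S.levels) : ℝ≥0∞ :=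
  min (ENNReal.ofReal w * S.f₁ i p x₁ + ENNReal.ofReal (1 - w) * S.f₁ i p x₂)
    (ENNReal.ofReal w * S.f₂ i p x₁ + ENNReal.ofReal (1 - w) * S.f₂ i p x₂)

/-- The value of the dual problem, `inf_{l ∈ [0,1]} sup_x (l f₁(x) + (1 - l) f₂(x))`, with the
convention `0 * ∞ = 0`. -/
def dualValue (i : Fin (S.J + 1)) (p : S.abilities) : ℝ≥0∞ :=
  ⨅ l ∈ Icc (0 : ℝ) 1, ⨆ x : S.levels,
    (ENNReal.ofReal l * S.f₁ i p x + ENNReal.ofReal (1 - l) * S.f₂ i p x)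

end GradingProblem

end

/-!
The lower bound is a change-of-measure argument. On the first `n` rounds, the laws of the
observations at abilities `p` and `u` have the density `exp (-L)`, where the log-likelihood ratio
`L` only involves the responses, since the questions are chosen in the same way at both abilities
(`Algorithm.lintegral_law_change`). This passes to the bounded time `min τ n`
(`Algorithm.setLIntegral_exp_neg_stoppedLogRatio`), while the mean of the stopped log-likelihood
ratio at `p` is the expected sum of the divergences `d(h(X,p) | h(X,u))` over the questions asked
(`Algorithm.integral_stoppedLogRatio`). Integrating `t ≥ c + 1 - exp (c - t)`, with
`t` the stopped log-likelihood ratio and `c = ± log ((1 - δ) / δ)` according to whether the grade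
of `p` is announced by time `n`, bounds this mean below by about
`(1 - 2 δ) log ((1 - δ) / δ) ≥ log (1 / (2.4 δ))` (`Algorithm.le_integral_stoppedLogRatio`,
`log_inv_le_klBer_compl`). Letting `n → ∞`, and then letting `u` tend to a grade boundary where
`δ`-correctness demands nothing, shows that the expected numbers of questions at the different
levels, divided by `log (1 / (2.4 δ))`, form a feasible measure
(`Algorithm.IsDeltaCorrect.mStar_le`).

For the variational problem, `klBer q r` grows as `r` moves away from `q`, so that all constraints
follow from those at the two boundaries of the bracket (`feasible_iff_boundary`). What remains is a
covering problem with two continuous positive payoffs on a compact set. A minimizer `l` of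
`max_x (l g₁ x + (1 - l) g₂ x)`, together with two maximizers obtained as limits from either side of
`l`, is a saddle point (`exists_saddle`), and the value, the two-point solution and the dual value
are all read off from it (`duality_of_payoffs`). A missing boundary has infinite divergence: if
one is missing, the other payoff is used twice, and if both are missing, the zero measure is
optimal.
-/

/-! ### The Bernoulli divergence -/

lemma klBer_self {q : ℝ} (hq : q ∈ Ioo (0 : ℝ) 1) : klBer q q = 0 := by
  have h1 : q ≠ 0 := hq.1.ne'
  have h2 : 1 - q ≠ 0 := (sub_pos.2 hq.2).ne'
  simp [klBer, h1, h2]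

lemma klBer_pos {q r : ℝ} (hq : q ∈ Ioo (0 : ℝ) 1) (hr : r ∈ Ioo (0 : ℝ) 1) (hne : q ≠ r) :
    0 < klBer q r := by
  obtain ⟨hq0, hq1⟩ := hq
  obtain ⟨hr0, hr1⟩ := hr
  have hq1' : 0 < 1 - q := sub_pos.2 hq1
  have hr1' : 0 < 1 - r := sub_pos.2 hr1
  have h1 : Real.log (r / q) < r / q - 1 :=
    Real.log_lt_sub_one_of_pos (by positivity) fun h => hne ((div_eq_one_iff_eq hq0.ne').1 h).symm
  have h2 : Real.log ((1 - r) / (1 - q)) ≤ (1 - r) / (1 - q) - 1 :=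
    Real.log_le_sub_one_of_pos (by positivity)
  have h3 : q * Real.log (r / q) < r - q := by
    calc _ < q * (r / q - 1) := mul_lt_mul_of_pos_left h1 hq0
      _ = r - q := by field_simp
  have h4 : (1 - q) * Real.log ((1 - r) / (1 - q)) ≤ q - r := by
    calc _ ≤ (1 - q) * ((1 - r) / (1 - q) - 1) := mul_le_mul_of_nonneg_left h2 hq1'.le
      _ = q - r := by field_simp; ring
  rw [klBer, ← inv_div r q, ← inv_div (1 - r) (1 - q), Real.log_inv, Real.log_inv]
  linarith

lemma klBer_nonneg {q r : ℝ} (hq : q ∈ Ioo (0 : ℝ) 1) (hr : r ∈ Ioo (0 : ℝ) 1) :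
    0 ≤ klBer q r := by
  rcases eq_or_ne q r with rfl | h
  · exact (klBer_self hq).ge
  · exact (klBer_pos hq hr h).le

/-- The difference of two divergences from `q` is bounded below by its linearization. -/
lemma le_klBer_sub_klBer {q r r' : ℝ} (hq : q ∈ Ioo (0 : ℝ) 1) (hr : r ∈ Ioo (0 : ℝ) 1)
    (hr' : r' ∈ Ioo (0 : ℝ) 1) :
    (r' - r) * ((1 - q) / (1 - r) - q / r) ≤ klBer q r' - klBer q r := by
  obtain ⟨hq0, hq1⟩ := hq
  obtain ⟨hr0, hr1⟩ := hr
  obtain ⟨hs0, hs1⟩ := hr'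
  have hq1' : 0 < 1 - q := sub_pos.2 hq1
  have hr1' : 0 < 1 - r := sub_pos.2 hr1
  have hs1' : 0 < 1 - r' := sub_pos.2 hs1
  have h1 : Real.log (r' / r) ≤ r' / r - 1 := Real.log_le_sub_one_of_pos (by positivity)
  have h2 : Real.log ((1 - r') / (1 - r)) ≤ (1 - r') / (1 - r) - 1 :=
    Real.log_le_sub_one_of_pos (by positivity)
  have h3 := mul_le_mul_of_nonneg_left h1 hq0.le
  have h4 := mul_le_mul_of_nonneg_left h2 hq1'.le
  have e : (r' - r) * ((1 - q) / (1 - r) - q / r) =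
      -(q * (r' / r - 1)) - (1 - q) * ((1 - r') / (1 - r) - 1) := by field_simp; ring
  rw [e]
  rw [Real.log_div hs0.ne' hr0.ne'] at h3
  rw [Real.log_div hs1'.ne' hr1'.ne'] at h4
  rw [klBer, klBer, Real.log_div hq0.ne' hs0.ne', Real.log_div hq0.ne' hr0.ne',
    Real.log_div hq1'.ne' hs1'.ne', Real.log_div hq1'.ne' hr1'.ne']
  linarith

lemma klBer_le_klBer_of_le {q r r' : ℝ} (hq : q ∈ Ioo (0 : ℝ) 1) (hr : r ∈ Ioo (0 : ℝ) 1)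
    (hr' : r' ∈ Ioo (0 : ℝ) 1) (h : q ≤ r) (h' : r ≤ r') : klBer q r ≤ klBer q r' := by
  have h1 : 1 ≤ (1 - q) / (1 - r) := (one_le_div (sub_pos.2 hr.2)).2 (by linarith)
  have h2 : q / r ≤ 1 := (div_le_one hr.1).2 h
  have := le_klBer_sub_klBer hq hr hr'
  have := mul_nonneg (sub_nonneg.2 h') (sub_nonneg.2 (h2.trans h1))
  linarith

lemma klBer_le_klBer_of_ge {q r r' : ℝ} (hq : q ∈ Ioo (0 : ℝ) 1) (hr : r ∈ Ioo (0 : ℝ) 1)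
    (hr' : r' ∈ Ioo (0 : ℝ) 1) (h : r ≤ q) (h' : r' ≤ r) : klBer q r ≤ klBer q r' := by
  have h1 : (1 - q) / (1 - r) ≤ 1 := (div_le_one (sub_pos.2 hr.2)).2 (by linarith)
  have h2 : 1 ≤ q / r := (one_le_div hr.1).2 h
  have := le_klBer_sub_klBer hq hr hr'
  have := mul_nonneg_of_nonpos_of_nonpos (sub_nonpos.2 h') (sub_nonpos.2 (h1.trans h2))
  linarith

/-- Tangent line bound at `a` for the concave function
`t ↦ -2 t log t - (1 - 2 t) log (1 - t)`. -/
lemma binary_entropy_tangent {t a : ℝ} (ht : t ∈ Ioo (0 : ℝ) 1) (ha : a ∈ Ioo (0 : ℝ) 1) :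
    -(2 * t * Real.log t) - (1 - 2 * t) * Real.log (1 - t) ≤
      -(2 * t * Real.log a) + 2 * (a - t) - 2 * (1 - t) * Real.log (1 - a) + 2 * (t - a)
        + Real.log (1 - a) + ((1 - t) / (1 - a) - 1) := by
  obtain ⟨ht0, ht1⟩ := ht
  obtain ⟨ha0, ha1⟩ := ha
  have ht1' : 0 < 1 - t := sub_pos.2 ht1
  have ha1' : 0 < 1 - a := sub_pos.2 ha1
  have h1 : Real.log (a / t) ≤ a / t - 1 := Real.log_le_sub_one_of_pos (by positivity)
  have h2 : Real.log ((1 - a) / (1 - t)) ≤ (1 - a) / (1 - t) - 1 :=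
    Real.log_le_sub_one_of_pos (by positivity)
  have h3 : Real.log ((1 - t) / (1 - a)) ≤ (1 - t) / (1 - a) - 1 :=
    Real.log_le_sub_one_of_pos (by positivity)
  have h4 : t * Real.log (a / t) ≤ a - t := by
    calc _ ≤ t * (a / t - 1) := mul_le_mul_of_nonneg_left h1 ht0.le
      _ = _ := by field_simp
  have h5 : (1 - t) * Real.log ((1 - a) / (1 - t)) ≤ t - a := by
    calc _ ≤ (1 - t) * ((1 - a) / (1 - t) - 1) := mul_le_mul_of_nonneg_left h2 ht1'.le
      _ = _ := by field_simp; ring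
  rw [Real.log_div ha0.ne' ht0.ne'] at h4
  rw [Real.log_div ha1'.ne' ht1'.ne'] at h5
  rw [Real.log_div ht1'.ne' ha1'.ne'] at h3
  linarith

lemma lt_log_twelve_fifths : 0.875 < Real.log 2.4 := by
  have e : Real.log 2.4 = 2 * Real.log 2 + Real.log 3 - Real.log 5 := by
    rw [show (2.4 : ℝ) = 2 ^ 2 * 3 / 5 by norm_num,
      Real.log_div (by norm_num) (by norm_num), Real.log_mul (by norm_num) (by norm_num),
      Real.log_pow]
    norm_num
  rw [e]
  linarith [Real.log_two_gt_d9, Real.log_three_gt_d9, Real.log_five_lt_d9]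

/-- The standard bound `d(1 - δ | δ) ≥ log (1 / (2.4 δ))`, where
`d(1 - δ | δ) = (1 - 2 δ) log ((1 - δ) / δ)`. -/
lemma log_inv_le_klBer_compl {δ : ℝ} (h0 : 0 < δ) (h1 : 2.4 * δ < 1) :
    Real.log (1 / (2.4 * δ)) ≤ (1 - 2 * δ) * Real.log ((1 - δ) / δ) := by
  have hδ : δ < 5 / 12 := by norm_num at h1 ⊢; linarith
  have h1' : 0 < 1 - δ := by linarith
  rw [one_div, Real.log_inv, Real.log_mul (by norm_num) h0.ne', Real.log_div h1'.ne' h0.ne']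
  have hδI : δ ∈ Ioo (0 : ℝ) 1 := ⟨h0, by linarith⟩
  have key : -(2 * δ * Real.log δ) - (1 - 2 * δ) * Real.log (1 - δ) ≤ 0.875 := by
    have a1 := Real.log_three_lt_d9
    have a2 := Real.log_three_gt_d9
    have a3 := Real.log_two_gt_d9
    have a4 := Real.log_two_lt_d9
    -- the tangent at `1/3` is good enough to the right of `0.27`, the tangent at `1/4` to the left
    rcases le_total 0.27 δ with hc | hc
    · have h := binary_entropy_tangent hδI (a := 1 / 3) (by norm_num)
      have e1 : Real.log (1 / 3) = -Real.log 3 := by rw [one_div, Real.log_inv]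
      have e2 : Real.log (1 - 1 / 3) = Real.log 2 - Real.log 3 := by
        rw [show (1 : ℝ) - 1 / 3 = 2 / 3 by norm_num, Real.log_div (by norm_num) (by norm_num)]
      rw [e1, e2] at h
      norm_num at hc a1 a2 a3 a4 h ⊢
      nlinarith [mul_le_mul_of_nonneg_right a4.le h0.le]
    · have h := binary_entropy_tangent hδI (a := 1 / 4) (by norm_num)
      have e1 : Real.log (1 / 4) = -(2 * Real.log 2) := by
        rw [one_div, Real.log_inv, show (4 : ℝ) = 2 ^ 2 by norm_num, Real.log_pow]; norm_num
      have e2 : Real.log (1 - 1 / 4) = Real.log 3 - 2 * Real.log 2 := by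
        rw [show (1 : ℝ) - 1 / 4 = 3 / 2 ^ 2 by norm_num,
          Real.log_div (by norm_num) (by norm_num), Real.log_pow]
        norm_num
      rw [e1, e2] at h
      norm_num at hc a1 a2 a3 a4 h ⊢
      nlinarith [mul_le_mul_of_nonneg_right a1.le h0.le]
  have := lt_log_twelve_fifths
  linarith

/-! ### A minimax theorem for two payoffs -/

/-- If `t < 1` minimizes the worst case `s ↦ max_x (s a x + (1 - s) b x)` over `[0, 1]`, with
value at least `V`, then some `x` that attains `V` at `t` has `b x ≤ a x`: it is a limit of
maximizers for parameters decreasing to `t`. -/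
lemma exists_maximizer_of_isMinOn {X : Type*} [MetricSpace X] [CompactSpace X] {a b : X → ℝ}
    (ha : Continuous a) (hb : Continuous b) {t V : ℝ} (ht : t ∈ Ico (0 : ℝ) 1)
    (hV : ∀ s ∈ Icc (0 : ℝ) 1, ∃ x, V ≤ s * a x + (1 - s) * b x)
    (htV : ∀ x, t * a x + (1 - t) * b x ≤ V) :
    ∃ x, t * a x + (1 - t) * b x = V ∧ b x ≤ a x := by
  set s : ℕ → ℝ := fun n => t + (1 - t) * (1 / ((n : ℝ) + 1)) with hs
  have h1t : 0 < 1 - t := sub_pos.2 ht.2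
  have hts : ∀ n, t < s n := fun n => by
    have : 0 < (1 - t) * (1 / ((n : ℝ) + 1)) := by positivity
    simp only [hs]; linarith
  have hs1 : ∀ n, s n ≤ 1 := fun n => by
    have : (1 : ℝ) / ((n : ℝ) + 1) ≤ 1 := by
      rw [div_le_one (by positivity)]; linarith [n.cast_nonneg (α := ℝ)]
    have := mul_le_mul_of_nonneg_left this h1t.le
    simp only [hs]; linarith
  have hlim : Filter.Tendsto s Filter.atTop (nhds t) := by
    have := (tendsto_one_div_add_atTop_nhds_zero_nat (𝕜 := ℝ)).const_mul (1 - t)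
    simpa [hs] using this.const_add t
  choose x hx using fun n => hV (s n) ⟨ht.1.trans (hts n).le, hs1 n⟩
  obtain ⟨y, φ, hφ, hy⟩ := CompactSpace.tendsto_subseq x
  have hsφ := hlim.comp hφ.tendsto_atTop
  have hay := (ha.tendsto y).comp hy
  have hby := (hb.tendsto y).comp hy
  refine ⟨y, le_antisymm (htV y) ?_, ?_⟩
  · refine ge_of_tendsto ((hsφ.mul hay).add ((hsφ.const_sub 1).mul hby))
      (Filter.Eventually.of_forall fun n => hx (φ n))
  · refine le_of_tendsto_of_tendsto' hby hay fun n => ?_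
    have h1 := hx (φ n)
    have h2 := htV (x (φ n))
    have h3 : 0 ≤ (s (φ n) - t) * (a (x (φ n)) - b (x (φ n))) := by linarith
    exact sub_nonneg.1 (nonneg_of_mul_nonneg_right h3 (sub_pos.2 (hts _)))

/-- Minimax theorem for two continuous payoffs on a compact space: the max-min value over mixtures
is attained by a mixture of two points, and the same value bounds a weighted average of the two
payoffs everywhere. -/
lemma exists_saddle {X : Type*} [MetricSpace X] [CompactSpace X] [Nonempty X] {a b : X → ℝ}
    (ha : Continuous a) (hb : Continuous b) :
    ∃ V : ℝ, ∃ w ∈ Icc (0 : ℝ) 1, ∃ x₁ x₂ : X, ∃ l ∈ Icc (0 : ℝ) 1,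
      V ≤ w * a x₁ + (1 - w) * a x₂ ∧ V ≤ w * b x₁ + (1 - w) * b x₂ ∧
        ∀ x, l * a x + (1 - l) * b x ≤ V := by
  let f : ℝ → X → ℝ := fun s x => s * a x + (1 - s) * b x
  have hf : Continuous (Function.uncurry f) := by
    simp only [Function.uncurry_def, f]; fun_prop
  have hφ : Continuous fun s => sSup (f s '' univ) := isCompact_univ.continuous_sSup hf
  obtain ⟨l, hl, hmin⟩ := (isCompact_Icc (a := (0 : ℝ)) (b := 1)).exists_isMinOn
    (nonempty_Icc.2 zero_le_one) hφ.continuousOn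
  set V := sSup (f l '' univ) with hVdef
  have hfs : ∀ s, Continuous (f s) := fun s => by simp only [f]; fun_prop
  have hlV : ∀ x, l * a x + (1 - l) * b x ≤ V := fun x =>
    le_csSup (isCompact_univ.image (hfs l)).bddAbove ⟨x, mem_univ x, rfl⟩
  have hV : ∀ s ∈ Icc (0 : ℝ) 1, ∃ x, V ≤ s * a x + (1 - s) * b x := fun s hs => by
    obtain ⟨x, -, hx⟩ := isCompact_univ.exists_sSup_image_eq univ_nonempty (hfs s).continuousOn
    exact ⟨x, (isMinOn_iff.1 hmin s hs).trans hx.le⟩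
  -- the same statement with the roles of `a` and `b` exchanged
  have hV' : ∀ s ∈ Icc (0 : ℝ) 1, ∃ x, V ≤ s * b x + (1 - s) * a x := fun s hs => by
    obtain ⟨x, hx⟩ := hV (1 - s) ⟨by linarith [hs.2], by linarith [hs.1]⟩
    exact ⟨x, by linarith⟩
  rcases hl.2.eq_or_lt with h1 | h1
  · obtain ⟨x, hx, hab⟩ := exists_maximizer_of_isMinOn hb ha (t := 0) ⟨le_rfl, one_pos⟩ hV'
      (fun x => by have := hlV x; rw [h1] at this; linarith)
    exact ⟨V, 1, ⟨zero_le_one, le_rfl⟩, x, x, l, hl, by linarith, by linarith, hlV⟩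
  obtain ⟨x₁, hx₁, hab₁⟩ := exists_maximizer_of_isMinOn ha hb ⟨hl.1, h1⟩ hV hlV
  rcases hl.1.eq_or_lt with h0 | h0
  · rw [← h0] at hx₁
    exact ⟨V, 1, ⟨zero_le_one, le_rfl⟩, x₁, x₁, l, hl, by linarith, by linarith, hlV⟩
  obtain ⟨x₂, hx₂, hab₂⟩ := exists_maximizer_of_isMinOn hb ha (t := 1 - l)
    ⟨by linarith, by linarith⟩ hV' (fun x => by linarith [hlV x])
  -- both points maximize the same average, so it is enough to balance `a` and `b`
  obtain ⟨w, hw, hbal⟩ : ∃ w ∈ Icc (0 : ℝ) 1,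
      w * (a x₁ - b x₁) + (1 - w) * (a x₂ - b x₂) = 0 := by
    rcases hab₁.eq_or_lt with he | hlt
    · exact ⟨1, ⟨zero_le_one, le_rfl⟩, by linarith⟩
    · have hd : 0 < (a x₁ - b x₁) + (b x₂ - a x₂) := by linarith
      refine ⟨(b x₂ - a x₂) / ((a x₁ - b x₁) + (b x₂ - a x₂)),
        ⟨div_nonneg (by linarith) hd.le, (div_le_one hd).2 (by linarith)⟩, ?_⟩
      field_simp
      ring
  have e : w * (l * a x₁ + (1 - l) * b x₁) + (1 - w) * (l * a x₂ + (1 - l) * b x₂) = V := by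
    rw [hx₁, show l * a x₂ + (1 - l) * b x₂ = V by linarith]; ring
  refine ⟨V, w, hw, x₁, x₂, l, hl, le_of_eq ?_, le_of_eq ?_, hlV⟩
  · linear_combination -e - (1 - l) * hbal
  · linear_combination -e + l * hbal

namespace GradingProblem

variable {S : GradingProblem}

/-! ### The law of the observations -/

/-- The first `s` rounds of a path. -/
def past (s : ℕ) (ω : S.Path) : Fin s → S.Round := fun k => ω k

@[fun_prop]
lemma measurable_past (s : ℕ) : Measurable (past (S := S) s) := by
  unfold past; fun_prop

lemma measurable_finSnoc (s : ℕ) :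
    Measurable fun q : (Fin s → S.Round) × S.Round =>
      (Fin.snoc q.1 q.2 : Fin (s + 1) → S.Round) := by
  refine measurable_pi_iff.2 fun k => ?_
  refine Fin.lastCases ?_ (fun k => ?_) k
  · simpa using measurable_snd
  · simp only [Fin.snoc_castSucc]; fun_prop

lemma past_succ (s : ℕ) (ω : S.Path) : past (s + 1) ω = Fin.snoc (past s ω) (ω s) := by
  funext k
  refine Fin.lastCases ?_ (fun k => ?_) k <;> simp [past]

instance (A : S.Algorithm) (p : S.abilities) : IsProbabilityMeasure (A.law p) := by
  unfold Algorithm.law; infer_instance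

lemma lintegral_response (p : S.abilities) (x : S.levels) (G : Bool → ℝ≥0∞) :
    ∫⁻ b, G b ∂S.response p x =
      ENNReal.ofReal (S.h x p) * G true + ENNReal.ofReal (1 - S.h x p) * G false := by
  have h : S.response p x = bernoulliMeasure true false ⟨S.h x p, S.h_mem_unitInterval p x⟩ := rfl
  rw [h, bernoulliMeasure_def, lintegral_add_measure]
  rw [lintegral_smul_measure, lintegral_smul_measure, lintegral_dirac, lintegral_dirac,
    ENNReal.smul_def, ENNReal.smul_def, smul_eq_mul, smul_eq_mul]
  congr 2 <;> exact (ENNReal.ofReal_eq_coe_nnreal _).symm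

/-- The law of the next question given the first `s` rounds. -/
noncomputable def Algorithm.question (A : S.Algorithm) :
    (s : ℕ) → Kernel (Fin s → S.Round) S.levels
  | 0 => Kernel.const _ A.first
  | n + 1 => (A.next n).comap
      (fun v (k : Finset.Iic n) => v ⟨k, Nat.lt_succ_of_le (Finset.mem_Iic.1 k.2)⟩) (by fun_prop)

instance (A : S.Algorithm) (s : ℕ) : IsMarkovKernel (A.question s) := by
  cases s <;> (unfold Algorithm.question; infer_instance)

lemma Algorithm.map_law_zero (A : S.Algorithm) (p : S.abilities) :
    (A.law p).map (fun ω => ω 0) = A.first ⊗ₘ S.response p := by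
  have e : (fun ω : S.Path => ω 0) = (fun v : Finset.Iic 0 → S.Round => v ⟨0, by simp⟩) ∘
      Preorder.frestrictLe 0 := rfl
  rw [e, ← Measure.map_map (by fun_prop) (by fun_prop), Algorithm.law, Kernel.trajMeasure,
    Measure.map_comp _ _ (by fun_prop), Kernel.traj_map_frestrictLe, Kernel.partialTraj_self,
    Measure.id_comp, Measure.map_map (by fun_prop) (by fun_prop)]
  exact Measure.map_id

/-- The law of round `s` given the past: the question is drawn first, then the response to it. -/
lemma Algorithm.lintegral_law_succ (A : S.Algorithm) (p : S.abilities) (s : ℕ)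
    {Ψ : (Fin s → S.Round) × S.Round → ℝ≥0∞} (hΨ : Measurable Ψ) :
    ∫⁻ ω, Ψ (past s ω, ω s) ∂A.law p =
      ∫⁻ ω, ∫⁻ x, ∫⁻ b, Ψ (past s ω, (x, b)) ∂S.response p x ∂A.question s (past s ω)
        ∂A.law p := by
  cases s with
  | zero =>
    have e : ∀ ω : S.Path, past 0 ω = Fin.elim0 := fun ω => Subsingleton.elim _ _
    simp only [e, lintegral_const, measure_univ, mul_one, Algorithm.question, Kernel.const_apply]
    have hm : Measurable fun y : S.Round => Ψ (Fin.elim0, y) := by fun_prop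
    rw [← lintegral_map hm (measurable_pi_apply 0), A.map_law_zero,
      Measure.lintegral_compProd hm]
  | succ n =>
    let r : (Finset.Iic n → S.Round) → Fin (n + 1) → S.Round :=
      fun v k => v ⟨k, Finset.mem_Iic.2 (Nat.le_of_lt_succ k.2)⟩
    have hr : Measurable r := by fun_prop
    have hm : Measurable fun y : (Finset.Iic n → S.Round) × S.Round => Ψ (r y.1, y.2) := by
      fun_prop
    have key := Kernel.map_frestrictLe_trajMeasure_compProd_eq_map_trajMeasure
      (X := fun _ => S.Round) (μ₀ := A.first ⊗ₘ S.response p)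
      (κ := fun n => A.next n ⊗ₖ (S.response p).prodMkLeft (Finset.Iic n → S.Round)) (a := n)
    have h1 := congrArg (fun m => ∫⁻ y, Ψ (r y.1, y.2) ∂m) key
    rw [lintegral_map hm (by fun_prop), Measure.lintegral_compProd hm,
      lintegral_map hm.lintegral_kernel_prod_right' (by fun_prop)] at h1
    refine h1.symm.trans (lintegral_congr fun ω => ?_)
    rw [Kernel.lintegral_compProd _ _ _ (by fun_prop)]
    rfl

/-! ### Log-likelihood ratios and change of measure -/

variable (S) in
lemma continuous_h : Continuous fun z : S.abilities × S.levels => S.h z.2 z.1 :=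
  S.h_contDiff.continuousOn.comp_continuous
    (f := fun z : S.abilities × S.levels => ((z.2 : ℝ), (z.1 : ℝ)))
    (by fun_prop) fun z => ⟨S.levels_pos _ z.2.2, S.ability_pos z.1⟩

lemma h_mem_Ioo (p : S.abilities) (x : S.levels) : S.h x p ∈ Ioo (0 : ℝ) 1 :=
  S.h_mem x p (S.levels_pos x x.2) (S.ability_pos p)

lemma h_pos (p : S.abilities) (x : S.levels) : 0 < S.h x p := (h_mem_Ioo p x).1

lemma one_sub_h_pos (p : S.abilities) (x : S.levels) : 0 < 1 - S.h x p :=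
  sub_pos.2 (h_mem_Ioo p x).2

/-- The log-likelihood ratio, of ability `p` against ability `u`, of the response in a round. -/
noncomputable def logRatio (p u : S.abilities) (y : S.Round) : ℝ :=
  if y.2 then Real.log (S.h y.1 p / S.h y.1 u) else Real.log ((1 - S.h y.1 p) / (1 - S.h y.1 u))

lemma continuous_logRatio (p u : S.abilities) : Continuous (logRatio p u) := by
  have hc : ∀ v : S.abilities, Continuous fun x : S.levels => S.h x v := fun v =>
    (continuous_h S).comp (Continuous.prodMk_right v)
  have h1 : Continuous fun x : S.levels => Real.log (S.h x p / S.h x u) :=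
    ((hc p).div (hc u) fun x => (h_pos u x).ne').log
      fun x => (div_pos (h_pos p x) (h_pos u x)).ne'
  have h2 : Continuous fun x : S.levels => Real.log ((1 - S.h x p) / (1 - S.h x u)) :=
    ((continuous_const.sub (hc p)).div (continuous_const.sub (hc u))
      fun x => (one_sub_h_pos u x).ne').log
      fun x => (div_pos (one_sub_h_pos p x) (one_sub_h_pos u x)).ne'
  refine continuous_prod_of_discrete_right.2 fun b => ?_
  cases b
  · simpa [logRatio] using h2
  · simpa [logRatio] using h1

instance : CompactSpace S.levels := isCompact_iff_compactSpace.1 S.levels_compact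

lemma exists_abs_logRatio_le (p u : S.abilities) : ∃ C : ℝ, ∀ y, |logRatio p u y| ≤ C := by
  obtain ⟨C, hC⟩ := isCompact_univ.exists_bound_of_continuousOn
    (continuous_logRatio p u).continuousOn
  exact ⟨C, fun y => hC y (mem_univ y)⟩

@[fun_prop]
lemma measurable_logRatio (p u : S.abilities) : Measurable (logRatio p u) :=
  (continuous_logRatio p u).measurable

lemma lintegral_response_change (p u : S.abilities) (x : S.levels) (G : Bool → ℝ≥0∞) :
    ∫⁻ b, G b ∂S.response u x =
      ∫⁻ b, ENNReal.ofReal (Real.exp (-logRatio p u (x, b))) * G b ∂S.response p x := by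
  have hp := h_pos p x
  have hu := h_pos u x
  have hp' := one_sub_h_pos p x
  have hu' := one_sub_h_pos u x
  rw [lintegral_response, lintegral_response, ← mul_assoc, ← mul_assoc,
    ← ENNReal.ofReal_mul hp.le, ← ENNReal.ofReal_mul hp'.le]
  simp only [logRatio, if_true, Bool.false_eq_true, if_false]
  rw [← Real.log_inv, ← Real.log_inv, Real.exp_log (by positivity), Real.exp_log (by positivity),
    inv_div, inv_div, mul_div_cancel₀ _ hp.ne', mul_div_cancel₀ _ hp'.ne']

/-- On the first `s` rounds, the law at ability `u` has density `exp (-L)` with respect to the law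
at ability `p`, where `L` is the log-likelihood ratio of these rounds: the questions contribute
nothing, as their laws do not depend on the ability. -/
lemma Algorithm.lintegral_law_change (A : S.Algorithm) (p u : S.abilities) (s : ℕ)
    {Φ : (Fin s → S.Round) → ℝ≥0∞} (hΦ : Measurable Φ) :
    ∫⁻ ω, Φ (past s ω) ∂A.law u =
      ∫⁻ ω, ENNReal.ofReal (Real.exp (-∑ k : Fin s, logRatio p u (past s ω k))) * Φ (past s ω)
        ∂A.law p := by
  induction s with
  | zero =>
    have e : ∀ ω : S.Path, past 0 ω = Fin.elim0 := fun ω => Subsingleton.elim _ _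
    simp [e]
  | succ s ih =>
    have hm : Measurable fun q : (Fin s → S.Round) × S.Round => Φ (Fin.snoc q.1 q.2) :=
      hΦ.comp (measurable_finSnoc s)
    have hm1 : Measurable fun q : (Fin s → S.Round) × S.levels =>
        ∫⁻ b, Φ (Fin.snoc q.1 (q.2, b)) ∂S.response u q.2 :=
      Measurable.lintegral_kernel_prod_right'
        (κ := (S.response u).prodMkLeft (Fin s → S.Round))
        (f := fun z : ((Fin s → S.Round) × S.levels) × Bool =>
          Φ (Fin.snoc z.1.1 (z.1.2, z.2)))
        (hm.comp (g := fun q : (Fin s → S.Round) × S.Round => Φ (Fin.snoc q.1 q.2))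
          (f := fun z : ((Fin s → S.Round) × S.levels) × Bool => (z.1.1, (z.1.2, z.2)))
          (by fun_prop))
    have hm2 : Measurable fun v : Fin s → S.Round =>
        ∫⁻ x, ∫⁻ b, Φ (Fin.snoc v (x, b)) ∂S.response u x ∂A.question s v :=
      hm1.lintegral_kernel_prod_right'
    have hE : Measurable fun q : (Fin s → S.Round) × S.Round =>
        ENNReal.ofReal (Real.exp (-∑ k : Fin (s + 1),
          logRatio p u ((Fin.snoc q.1 q.2 : Fin (s + 1) → S.Round) k))) *
            Φ (Fin.snoc q.1 q.2) := by
      refine Measurable.mul ?_ hm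
      have := measurable_finSnoc (S := S) s
      fun_prop
    simp only [past_succ]
    rw [A.lintegral_law_succ u s hm, ih hm2, A.lintegral_law_succ p s hE]
    refine lintegral_congr fun ω => ?_
    rw [← lintegral_const_mul' _ _ ENNReal.ofReal_ne_top]
    refine lintegral_congr fun x => ?_
    rw [lintegral_response_change p u x, ← lintegral_const_mul' _ _ ENNReal.ofReal_ne_top]
    refine lintegral_congr fun b => ?_
    rw [Fin.sum_univ_castSucc, neg_add, Real.exp_add, ENNReal.ofReal_mul (Real.exp_nonneg _),
      mul_assoc]
    simp

/-- Given the past and the question, the response in round `s` has the law `S.response p`. -/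
lemma Algorithm.setLIntegral_round (A : S.Algorithm) (p : S.abilities) (s : ℕ) {B : Set S.Path}
    (hB : MeasurableSet[S.observed s] B) {G : S.Round → ℝ≥0∞} (hG : Measurable G) :
    ∫⁻ ω in B, G (ω s) ∂A.law p =
      ∫⁻ ω in B, ∫⁻ b, G ((ω s).1, b) ∂S.response p (ω s).1 ∂A.law p := by
  obtain ⟨B', hB', rfl⟩ := hB
  have hBm : MeasurableSet (past s ⁻¹' B' : Set S.Path) := measurable_past s hB'
  have hG' : Measurable fun y : S.Round => ∫⁻ b, G (y.1, b) ∂S.response p y.1 :=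
    (Measurable.lintegral_kernel_prod_right' (κ := S.response p) hG).comp measurable_fst
  have key : ∀ F : S.Round → ℝ≥0∞, Measurable F → ∫⁻ ω in past s ⁻¹' B', F (ω s) ∂A.law p =
      ∫⁻ ω, ∫⁻ x, ∫⁻ b, B'.indicator 1 (past s ω) * F (x, b) ∂S.response p x
        ∂A.question s (past s ω) ∂A.law p := fun F hF => by
    rw [← A.lintegral_law_succ p s (Ψ := fun q => B'.indicator 1 q.1 * F q.2)
      (((measurable_one.indicator hB').comp measurable_fst).mul (hF.comp measurable_snd)),
      ← lintegral_indicator hBm]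
    refine lintegral_congr fun ω => ?_
    by_cases h : past s ω ∈ B'
    · rw [indicator_of_mem (show ω ∈ past s ⁻¹' B' from h), indicator_of_mem h]; simp
    · rw [indicator_of_notMem (show ω ∉ past s ⁻¹' B' from h), indicator_of_notMem h]; simp
  refine (key G hG).trans (Eq.trans ?_ (key _ hG').symm)
  refine lintegral_congr fun ω => lintegral_congr fun x => ?_
  have ht : B'.indicator (1 : (Fin s → S.Round) → ℝ≥0∞) (past s ω) ≠ ⊤ := by
    by_cases h : past s ω ∈ B' <;> simp [h]
  simp only [lintegral_const_mul' _ _ ht, lintegral_const, measure_univ, mul_one]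

lemma klBer_eq_logRatio (p u : S.abilities) (x : S.levels) :
    klBer (S.h x p) (S.h x u) =
      S.h x p * logRatio p u (x, true) + (1 - S.h x p) * logRatio p u (x, false) := by
  simp [klBer, logRatio]

lemma continuous_klBer (p : S.abilities) : Continuous
    fun z : S.abilities × S.levels => klBer (S.h z.2 p) (S.h z.2 z.1) := by
  have hu := continuous_h S
  have hp : Continuous fun z : S.abilities × S.levels => S.h z.2 p :=
    hu.comp (continuous_const.prodMk continuous_snd)
  unfold klBer
  refine (hp.mul ((hp.div hu fun z => (h_pos z.1 z.2).ne').log fun z => ?_)).add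
    ((continuous_const.sub hp).mul (((continuous_const.sub hp).div (continuous_const.sub hu)
      fun z => (one_sub_h_pos z.1 z.2).ne').log fun z => ?_))
  · exact (div_pos (h_pos p z.2) (h_pos z.1 z.2)).ne'
  · exact (div_pos (one_sub_h_pos p z.2) (one_sub_h_pos z.1 z.2)).ne'

lemma continuous_klBer_right (p u : S.abilities) :
    Continuous fun x : S.levels => klBer (S.h x p) (S.h x u) :=
  (continuous_klBer p).comp (Continuous.prodMk_right u)

lemma Algorithm.integrable_logRatio (A : S.Algorithm) (p u : S.abilities) (s : ℕ) :
    Integrable (fun ω => logRatio p u (ω s)) (A.law p) := by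
  obtain ⟨C, hC⟩ := exists_abs_logRatio_le p u
  exact Integrable.of_bound
    ((measurable_logRatio p u).comp (measurable_pi_apply s)).aestronglyMeasurable C
    (ae_of_all _ fun ω => hC (ω s))

lemma integrable_klBer (p u : S.abilities) (m : Measure S.levels) [IsFiniteMeasure m] :
    Integrable (fun x : S.levels => klBer (S.h x p) (S.h x u)) m :=
  integrableOn_univ.1
    ((continuous_klBer_right p u).continuousOn.integrableOn_compact isCompact_univ)

lemma Algorithm.integrable_klBer (A : S.Algorithm) (p u : S.abilities) (s : ℕ) :
    Integrable (fun ω => klBer (S.h (ω s).1 p) (S.h (ω s).1 u)) (A.law p) := by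
  obtain ⟨C, hC⟩ := isCompact_univ.exists_bound_of_continuousOn
    (continuous_klBer_right p u).continuousOn
  exact Integrable.of_bound ((continuous_klBer_right p u).measurable.comp
    (measurable_fst.comp (measurable_pi_apply s))).aestronglyMeasurable C
    (ae_of_all _ fun ω => hC _ (mem_univ (ω s).1))

/-- Wald's identity for a single round: on an event decided before the round, the log-likelihood
ratio of the response has the same mean as its conditional mean, the divergence. -/
lemma Algorithm.setIntegral_logRatio (A : S.Algorithm) (p u : S.abilities) (s : ℕ)
    {B : Set S.Path} (hB : MeasurableSet[S.observed s] B) :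
    ∫ ω in B, logRatio p u (ω s) ∂A.law p =
      ∫ ω in B, klBer (S.h (ω s).1 p) (S.h (ω s).1 u) ∂A.law p := by
  obtain ⟨C, hC⟩ := exists_abs_logRatio_le p u
  have hpos : ∀ y, 0 ≤ logRatio p u y + C := fun y => by linarith [(abs_le.1 (hC y)).1]
  have hsum : ∀ x, ∫⁻ b, ENNReal.ofReal (logRatio p u (x, b) + C) ∂S.response p x =
      ENNReal.ofReal (klBer (S.h x p) (S.h x u) + C) := fun x => by
    have hp := (h_pos p x).le
    have hp' := (one_sub_h_pos p x).le
    rw [lintegral_response, ← ENNReal.ofReal_mul hp, ← ENNReal.ofReal_mul hp',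
      ← ENNReal.ofReal_add (mul_nonneg hp (hpos _)) (mul_nonneg hp' (hpos _)),
      klBer_eq_logRatio]
    congr 1
    ring
  -- the shift by `C` makes both integrands nonnegative
  have h := A.setLIntegral_round p s hB (G := fun y => ENNReal.ofReal (logRatio p u y + C))
    (by fun_prop)
  simp only [hsum] at h
  have i1 := (A.integrable_logRatio p u s).integrableOn (s := B)
  have i2 := (A.integrable_klBer p u s).integrableOn (s := B)
  have iC : IntegrableOn (fun _ : S.Path => C) B (A.law p) := (integrable_const C).integrableOn
  have e : ∫ ω in B, (logRatio p u (ω s) + C) ∂A.law p =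
      ∫ ω in B, (klBer (S.h (ω s).1 p) (S.h (ω s).1 u) + C) ∂A.law p := by
    rw [integral_eq_lintegral_of_nonneg_ae (ae_of_all _ fun ω => hpos _)
        (f := fun ω : S.Path => logRatio p u (ω s) + C) (i1.add iC).aestronglyMeasurable,
      integral_eq_lintegral_of_nonneg_ae (ae_of_all _ fun ω => ?_)
        (f := fun ω : S.Path => klBer (S.h (ω s).1 p) (S.h (ω s).1 u) + C)
        (i2.add iC).aestronglyMeasurable, h]
    have h0 := klBer_nonneg (h_mem_Ioo p (ω s).1) (h_mem_Ioo u (ω s).1)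
    have hC0 : 0 ≤ C := (abs_nonneg _).trans (hC (ω s))
    simp only [Pi.zero_apply]
    linarith
  rw [integral_add i1 iC, integral_add i2 iC] at e
  linarith

/-! ### The transportation inequality for a stopped algorithm -/

lemma Algorithm.measurableSet_le_τ (A : S.Algorithm) (n : ℕ) :
    MeasurableSet[S.observed n] {ω | A.τ ω ≤ n} := A.isStoppingTime n

lemma Algorithm.measurableSet_lt_τ (A : S.Algorithm) (n : ℕ) :
    MeasurableSet[S.observed n] {ω | (n : ℕ∞) < A.τ ω} := by
  have h := (A.measurableSet_le_τ n).compl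
  have e : {ω | A.τ ω ≤ n}ᶜ = {ω | (n : ℕ∞) < A.τ ω} := by ext ω; simp
  rwa [e] at h

/-- The log-likelihood ratio of the rounds that are played before time `n`. -/
noncomputable def Algorithm.stoppedLogRatio (A : S.Algorithm) (p u : S.abilities) (n : ℕ)
    (ω : S.Path) : ℝ :=
  ∑ k ∈ Finset.range n, {ω | (k : ℕ∞) < A.τ ω}.indicator (fun ω => logRatio p u (ω k)) ω

@[fun_prop]
lemma Algorithm.measurable_stoppedLogRatio (A : S.Algorithm) (p u : S.abilities) (n : ℕ) :
    Measurable (A.stoppedLogRatio p u n) :=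
  Finset.measurable_fun_sum _ fun k _ => Measurable.indicator (by fun_prop)
    ((S.observed).le k _ (A.measurableSet_lt_τ k))

lemma Algorithm.exists_abs_stoppedLogRatio_le (A : S.Algorithm) (p u : S.abilities) (n : ℕ) :
    ∃ C : ℝ, ∀ ω, |A.stoppedLogRatio p u n ω| ≤ C := by
  obtain ⟨C, hC⟩ := exists_abs_logRatio_le p u
  refine ⟨∑ k ∈ Finset.range n, C, fun ω => (Finset.abs_sum_le_sum_abs _ _).trans
    (Finset.sum_le_sum fun k _ => ?_)⟩
  by_cases h : ω ∈ {ω | (k : ℕ∞) < A.τ ω}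
  · rw [indicator_of_mem h]; exact hC _
  · rw [indicator_of_notMem h, abs_zero]; exact (abs_nonneg _).trans (hC (ω k))

/-- Change of measure at the time `min τ n`, for events decided at that time. -/
lemma Algorithm.setLIntegral_exp_neg_stoppedLogRatio (A : S.Algorithm) (p u : S.abilities)
    (n : ℕ) {B : Set S.Path} (hB : MeasurableSet[S.observed n] B)
    (hBτ : ∀ k < n, MeasurableSet[S.observed k] (B ∩ {ω | A.τ ω ≤ k})) :
    ∫⁻ ω in B, ENNReal.ofReal (Real.exp (-A.stoppedLogRatio p u n ω)) ∂A.law p = A.law u B := by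
  have change : ∀ (n : ℕ) (B : Set S.Path), MeasurableSet[S.observed n] B →
      ∫⁻ ω in B, ENNReal.ofReal (Real.exp (-∑ k ∈ Finset.range n, logRatio p u (ω k))) ∂A.law p =
        A.law u B := by
    intro n B hB
    have hBm := (S.observed).le n _ hB
    obtain ⟨B', hB', rfl⟩ := hB
    rw [← lintegral_indicator_one hBm, ← lintegral_indicator hBm]
    have h := A.lintegral_law_change p u n (Φ := B'.indicator 1) (measurable_one.indicator hB')
    refine Eq.trans (lintegral_congr fun ω => ?_) h.symm
    by_cases hω : past n ω ∈ B'
    · rw [indicator_of_mem (show ω ∈ (fun (ω : S.Path) (s : Fin n) => ω s) ⁻¹' B' from hω),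
        indicator_of_mem hω, Pi.one_apply, mul_one, Finset.sum_range]
      rfl
    · rw [indicator_of_notMem (show ω ∉ (fun (ω : S.Path) (s : Fin n) => ω s) ⁻¹' B' from hω),
        indicator_of_notMem hω, mul_zero]
  induction n generalizing B with
  | zero => simpa [stoppedLogRatio] using change 0 B hB
  | succ n ih =>
    have hle : MeasurableSet[S.observed (n + 1)] {ω | A.τ ω ≤ n} :=
      (S.observed).mono n.le_succ _ (A.measurableSet_le_τ n)
    have hlem := (S.observed).le _ _ hle
    rw [← lintegral_inter_add_sdiff _ B hlem, ← measure_inter_add_sdiff B hlem]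
    congr 1
    · -- the run has stopped by time `n`, and round `n` is not played
      rw [← ih (hBτ n n.lt_succ_self) fun k hk => ?_]
      · refine setLIntegral_congr_fun ((S.observed).le _ _ (hBτ n n.lt_succ_self)) fun ω hω => ?_
        have hn : ω ∉ {ω | (n : ℕ∞) < A.τ ω} := fun (h : (n : ℕ∞) < A.τ ω) =>
          not_lt.2 (show A.τ ω ≤ n from hω.2) h
        simp only [stoppedLogRatio, Finset.sum_range_succ, indicator_of_notMem hn, add_zero]
      · have e : B ∩ {ω | A.τ ω ≤ n} ∩ {ω | A.τ ω ≤ k} = B ∩ {ω | A.τ ω ≤ k} := by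
          ext ω
          simp only [mem_inter_iff, mem_ofPred_eq]
          exact ⟨fun h => ⟨h.1.1, h.2⟩,
            fun h => ⟨⟨h.1, h.2.trans (Nat.cast_le.2 hk.le)⟩, h.2⟩⟩
        rw [e]
        exact hBτ k (hk.trans n.lt_succ_self)
    · -- all of the first `n + 1` rounds are played
      have hd : MeasurableSet[S.observed (n + 1)] (B \ {ω | A.τ ω ≤ n}) := hB.diff hle
      rw [← change (n + 1) _ hd]
      refine setLIntegral_congr_fun ((S.observed).le _ _ hd) fun ω hω => ?_
      have hn : ∀ k ∈ Finset.range (n + 1), {ω | (k : ℕ∞) < A.τ ω}.indicator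
          (fun ω => logRatio p u (ω k)) ω = logRatio p u (ω k) := fun k hk => by
        refine indicator_of_mem ?_ _
        have h1 : (n : ℕ∞) < A.τ ω := not_le.1 hω.2
        exact lt_of_le_of_lt (Nat.cast_le.2 (Nat.lt_succ_iff.1 (Finset.mem_range.1 hk))) h1
      simp only [stoppedLogRatio, Finset.sum_congr rfl hn]

lemma Algorithm.integral_stoppedLogRatio (A : S.Algorithm) (p u : S.abilities) (n : ℕ) :
    ∫ ω, A.stoppedLogRatio p u n ω ∂A.law p = ∑ k ∈ Finset.range n,
      ∫ ω in {ω | (k : ℕ∞) < A.τ ω}, klBer (S.h (ω k).1 p) (S.h (ω k).1 u) ∂A.law p := by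
  unfold stoppedLogRatio
  have hm : ∀ k : ℕ, MeasurableSet {ω | (k : ℕ∞) < A.τ ω} := fun k =>
    (S.observed).le k _ (A.measurableSet_lt_τ k)
  rw [integral_finsetSum _ fun k _ => (A.integrable_logRatio p u k).indicator (hm k)]
  exact Finset.sum_congr rfl fun k _ => (integral_indicator (hm k)).trans
    (A.setIntegral_logRatio p u k (A.measurableSet_lt_τ k))

lemma Algorithm.integrable_exp_neg_stoppedLogRatio (A : S.Algorithm) (p u : S.abilities) (n : ℕ) :
    Integrable (fun ω => Real.exp (-A.stoppedLogRatio p u n ω)) (A.law p) := by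
  obtain ⟨C, hC⟩ := A.exists_abs_stoppedLogRatio_le p u n
  refine Integrable.of_bound (by fun_prop) (Real.exp C) (ae_of_all _ fun ω => ?_)
  rw [Real.norm_eq_abs, Real.abs_exp, Real.exp_le_exp]
  linarith [(abs_le.1 (hC ω)).1]

lemma Algorithm.integrable_stoppedLogRatio (A : S.Algorithm) (p u : S.abilities) (n : ℕ) :
    Integrable (A.stoppedLogRatio p u n) (A.law p) := by
  obtain ⟨C, hC⟩ := A.exists_abs_stoppedLogRatio_le p u n
  exact Integrable.of_bound (by fun_prop) C (ae_of_all _ hC)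

/-- Bound on the mean of the stopped log-likelihood ratio over an event decided at time `min τ n`,
from `1 - t ≤ exp (-t)` at the log-likelihood ratio minus a constant. -/
lemma Algorithm.le_setIntegral_stoppedLogRatio (A : S.Algorithm) (p u : S.abilities)
    (n : ℕ) {B : Set S.Path} (hB : MeasurableSet[S.observed n] B)
    (hBτ : ∀ k < n, MeasurableSet[S.observed k] (B ∩ {ω | A.τ ω ≤ k})) (c : ℝ) :
    (c + 1) * (A.law p).real B - Real.exp c * (A.law u).real B ≤
      ∫ ω in B, A.stoppedLogRatio p u n ω ∂A.law p := by
  have hBm := (S.observed).le n _ hB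
  have iE := (A.integrable_exp_neg_stoppedLogRatio p u n).integrableOn (s := B)
  have iY := (A.integrable_stoppedLogRatio p u n).integrableOn (s := B)
  have hE : ∫ ω in B, Real.exp (-A.stoppedLogRatio p u n ω) ∂A.law p = (A.law u).real B := by
    rw [integral_eq_lintegral_of_nonneg_ae (ae_of_all _ fun ω => Real.exp_nonneg _)
      iE.aestronglyMeasurable, A.setLIntegral_exp_neg_stoppedLogRatio p u n hB hBτ, measureReal_def]
  have iC : IntegrableOn (fun _ : S.Path => c + 1) B (A.law p) :=
    (integrable_const _).integrableOn
  calc _ = ∫ ω in B, ((c + 1) - Real.exp c * Real.exp (-A.stoppedLogRatio p u n ω)) ∂A.law p := by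
        rw [integral_sub iC (iE.const_mul _), integral_const_mul, hE, setIntegral_const, smul_eq_mul,
          mul_comm (c + 1)]
    _ ≤ _ := by
        refine integral_mono (iC.sub (iE.const_mul _)) iY fun ω => ?_
        have := Real.add_one_le_exp (c + -A.stoppedLogRatio p u n ω)
        rw [Real.exp_add] at this
        simp only
        linarith

/-- If an event that is decided at time `min τ n` has probability at most `δ` at ability `u`, the
log-likelihood ratio collected up to that time has mean at least
`(2 a - 1) log ((1 - δ) / δ)` at ability `p`, where `a` is the probability of the event at `p`. -/
lemma Algorithm.le_integral_stoppedLogRatio (A : S.Algorithm) (p u : S.abilities)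
    (n : ℕ) {B : Set S.Path} (hB : MeasurableSet[S.observed n] B)
    (hBτ : ∀ k < n, MeasurableSet[S.observed k] (B ∩ {ω | A.τ ω ≤ k})) {δ : ℝ} (hδ : 0 < δ)
    (hδ' : δ < 1 / 2) (hu : (A.law u).real B ≤ δ) :
    (2 * (A.law p).real B - 1) * Real.log ((1 - δ) / δ) ≤
      ∫ ω, A.stoppedLogRatio p u n ω ∂A.law p := by
  have hBm := (S.observed).le n _ hB
  have hc : ∀ k < n, MeasurableSet[S.observed k] (Bᶜ ∩ {ω | A.τ ω ≤ k}) := fun k hk => by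
    have e : Bᶜ ∩ {ω | A.τ ω ≤ k} = {ω | A.τ ω ≤ k} \ (B ∩ {ω | A.τ ω ≤ k}) := by
      ext ω; simp only [mem_inter_iff, mem_compl_iff, mem_sdiff]; tauto
    rw [e]
    exact (A.measurableSet_le_τ k).diff (hBτ k hk)
  have h1 := A.le_setIntegral_stoppedLogRatio p u n hB hBτ (Real.log ((1 - δ) / δ))
  have h2 := A.le_setIntegral_stoppedLogRatio p u n hB.compl hc (-Real.log ((1 - δ) / δ))
  rw [← integral_add_compl hBm (A.integrable_stoppedLogRatio p u n)]
  have h1δ : 0 < 1 - δ := by linarith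
  rw [Real.exp_log (by positivity)] at h1
  rw [← Real.log_inv, inv_div, Real.exp_log (by positivity), probReal_compl_eq_one_sub hBm,
    probReal_compl_eq_one_sub hBm, ← inv_div, Real.log_inv] at h2
  set b := (A.law u).real B
  have h3 : (1 - δ) / δ * b + δ / (1 - δ) * (1 - b) ≤ 1 := by
    have e : 1 - ((1 - δ) / δ * b + δ / (1 - δ) * (1 - b)) =
        (δ - b) * ((1 - δ) / δ - δ / (1 - δ)) := by field_simp; ring
    have h4 : δ / (1 - δ) ≤ (1 - δ) / δ :=
      ((div_le_one h1δ).2 (by linarith)).trans ((one_le_div hδ).2 (by linarith))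
    have := mul_nonneg (sub_nonneg.2 hu) (sub_nonneg.2 h4)
    linarith
  rw [inv_div] at h2
  linarith

/-- The tail sum formula: a number of `ℕ∞` counts the natural numbers below it. -/
lemma tsum_ite_cast_lt (N : ℕ∞) : ∑' k : ℕ, (if (k : ℕ∞) < N then (1 : ℝ≥0∞) else 0) = N := by
  induction N using ENat.recTopCoe with
  | top => simp
  | coe n =>
    rw [tsum_eq_sum (s := Finset.range n) fun k hk => by simpa using hk,
      Finset.sum_congr rfl fun k hk => if_pos (Nat.cast_lt.2 (Finset.mem_range.1 hk))]
    simp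

lemma Algorithm.measurable_coe_τ (A : S.Algorithm) : Measurable fun ω => (A.τ ω : ℝ≥0∞) := by
  simp_rw [← tsum_ite_cast_lt]
  exact Measurable.tsum fun k => Measurable.ite
    ((S.observed).le k _ (A.measurableSet_lt_τ k)) measurable_const measurable_const

/-- The sum of divergences collected by a `δ`-correct algorithm at ability `p` suffices to tell `p`
from any ability in the interior of another bracket. -/
lemma Algorithm.IsDeltaCorrect.ofReal_log_le_tsum {A : S.Algorithm} {δ : ℝ}
    (hA : A.IsDeltaCorrect δ) (hδ : 0 < δ) (hδ' : 2.4 * δ < 1) {i j : Fin (S.J + 1)} (hij : j ≠ i)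
    {p u : S.abilities} (hp : (p : ℝ) ∈ S.openBracket i) (hu : (u : ℝ) ∈ S.openBracket j) :
    ENNReal.ofReal (Real.log (1 / (2.4 * δ))) ≤ ∑' k : ℕ, ∫⁻ ω in {ω | (k : ℕ∞) < A.τ ω},
      ENNReal.ofReal (klBer (S.h (ω k).1 p) (S.h (ω k).1 u)) ∂A.law p := by
  have hδ1 : δ < 1 / 2 := by norm_num at hδ' ⊢; linarith
  have h1δ : 0 < 1 - δ := by linarith
  set B : ℕ → Set S.Path := fun n => {ω | A.grade ω = i} ∩ {ω | A.τ ω ≤ n} with hBdef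
  have hB : ∀ n, MeasurableSet[S.observed n] (B n) :=
    fun n => (A.grade_measurable (measurableSet_singleton i)).2 n
  have hBmono : Monotone B := fun a b hab ω hω =>
    ⟨hω.1, le_trans (show A.τ ω ≤ a from hω.2) (Nat.cast_le.2 hab)⟩
  have hBτ : ∀ n, ∀ k < n, MeasurableSet[S.observed k] (B n ∩ {ω | A.τ ω ≤ k}) := fun n k hk => by
    have e : B n ∩ {ω | A.τ ω ≤ k} = B k := by
      ext ω
      exact ⟨fun h => ⟨h.1.1, h.2⟩, fun h => ⟨hBmono hk.le h, h.2⟩⟩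
    rw [e]
    exact hB k
  have hL : 0 ≤ Real.log ((1 - δ) / δ) :=
    Real.log_nonneg ((one_le_div hδ).2 (by linarith))
  have hBu : ∀ n, (A.law u).real (B n) ≤ δ := fun n => by
    refine ENNReal.toReal_le_of_le_ofReal hδ.le ((measure_mono fun ω hω => ?_).trans (hA j u hu).2)
    have h1 : A.grade ω = i := hω.1
    exact fun h => hij (h.symm.trans h1)
  have hstep : ∀ n, ENNReal.ofReal ((2 * (A.law p).real (B n) - 1) * Real.log ((1 - δ) / δ)) ≤
      ∑' k : ℕ, ∫⁻ ω in {ω | (k : ℕ∞) < A.τ ω},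
        ENNReal.ofReal (klBer (S.h (ω k).1 p) (S.h (ω k).1 u)) ∂A.law p := fun n => by
    have h := A.le_integral_stoppedLogRatio p u n (hB n) (hBτ n) hδ hδ1 (hBu n)
    rw [A.integral_stoppedLogRatio] at h
    have hnn : ∀ (k : ℕ) (ω : S.Path), 0 ≤ klBer (S.h (ω k).1 p) (S.h (ω k).1 u) := fun k ω =>
      klBer_nonneg (h_mem_Ioo p _) (h_mem_Ioo u _)
    refine ((ENNReal.ofReal_le_ofReal h).trans_eq ?_).trans (ENNReal.sum_le_tsum (Finset.range n))
    rw [ENNReal.ofReal_sum_of_nonneg fun k _ => integral_nonneg fun ω => hnn k ω]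
    exact Finset.sum_congr rfl fun k _ => ofReal_integral_eq_lintegral_ofReal
      (A.integrable_klBer p u k).integrableOn (ae_of_all _ fun ω => hnn k ω)
  have hlim : Filter.Tendsto (fun n => (A.law p).real (B n)) Filter.atTop
      (nhds ((A.law p).real (⋃ n, B n))) :=
    (ENNReal.tendsto_toReal (measure_ne_top _ _)).comp (tendsto_measure_iUnion_atTop hBmono)
  have hUm : MeasurableSet (⋃ n, B n) := MeasurableSet.iUnion fun n => (S.observed).le n _ (hB n)
  have hτ : A.law p {ω | A.τ ω = ⊤} = 0 := by
    have h := ae_lt_top A.measurable_coe_τ (hA i p hp).1.ne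
    refine measure_mono_null (fun ω hω => ?_) (ae_iff.1 h)
    have hω' : A.τ ω = ⊤ := hω
    simp [hω']
  have hcompl : A.law p (⋃ n, B n)ᶜ ≤ ENNReal.ofReal δ := by
    refine (measure_mono (t := {ω | A.grade ω ≠ i} ∪ {ω | A.τ ω = ⊤}) fun ω hω => ?_).trans
      ((measure_union_le _ _).trans ?_)
    · by_contra hcon
      simp only [mem_union, mem_ofPred_eq, not_or, not_not] at hcon
      obtain ⟨n, hn⟩ := ENat.ne_top_iff_exists.1 hcon.2
      exact hω (mem_iUnion.2 ⟨n, hcon.1, hn.symm.le⟩)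
    · rw [hτ, add_zero]
      exact (hA i p hp).2
  have hU : 1 - δ ≤ (A.law p).real (⋃ n, B n) := by
    have h := ENNReal.toReal_le_of_le_ofReal hδ.le hcompl
    rw [← measureReal_def, probReal_compl_eq_one_sub hUm] at h
    linarith
  refine (ENNReal.ofReal_le_ofReal ((log_inv_le_klBer_compl hδ hδ').trans
    (mul_le_mul_of_nonneg_right (by linarith) hL))).trans (le_of_tendsto'
      (ENNReal.tendsto_ofReal (((hlim.const_mul 2).sub_const 1).mul_const _)) hstep)

/-- The expected numbers of questions asked at the different levels. -/
noncomputable def Algorithm.occupation (A : S.Algorithm) (p : S.abilities) : Measure S.levels :=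
  Measure.sum fun k : ℕ => ((A.law p).restrict {ω | (k : ℕ∞) < A.τ ω}).map fun ω => (ω k).1

lemma Algorithm.lintegral_occupation (A : S.Algorithm) (p : S.abilities) {f : S.levels → ℝ≥0∞}
    (hf : Measurable f) : ∫⁻ x, f x ∂A.occupation p =
      ∑' k : ℕ, ∫⁻ ω in {ω | (k : ℕ∞) < A.τ ω}, f (ω k).1 ∂A.law p := by
  rw [occupation, lintegral_sum_measure]
  exact tsum_congr fun k => lintegral_map hf (measurable_fst.comp (measurable_pi_apply k))

lemma Algorithm.occupation_univ (A : S.Algorithm) (p : S.abilities) :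
    A.occupation p univ = A.expectedQuestions p := by
  have hm : ∀ k : ℕ, MeasurableSet {ω | (k : ℕ∞) < A.τ ω} := fun k =>
    (S.observed).le k _ (A.measurableSet_lt_τ k)
  rw [← lintegral_one, A.lintegral_occupation p measurable_const, Algorithm.expectedQuestions]
  simp_rw [← tsum_ite_cast_lt]
  rw [lintegral_tsum fun k => (Measurable.ite (hm k) measurable_const
    measurable_const).aemeasurable]
  refine tsum_congr fun k => ?_
  rw [← lintegral_indicator (hm k)]
  exact lintegral_congr fun ω => by simp [indicator_apply]

/-! ### Continuity and monotonicity in the alternative ability -/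

instance : DenselyOrdered S.abilities := inferInstanceAs (DenselyOrdered (Ioo S.pmin S.pmax))
instance : NoMaxOrder S.abilities := inferInstanceAs (NoMaxOrder (Ioo S.pmin S.pmax))
instance : NoMinOrder S.abilities := inferInstanceAs (NoMinOrder (Ioo S.pmin S.pmax))
instance : OrderTopology S.abilities := inferInstanceAs (OrderTopology (Ioo S.pmin S.pmax))
instance : LocallyCompactSpace S.abilities :=
  (isOpen_Ioo (a := S.pmin) (b := S.pmax)).locallyCompactSpace

lemma continuous_lintegral_klBer (p : S.abilities) (m : Measure S.levels) [IsFiniteMeasure m] :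
    Continuous fun u : S.abilities =>
      ∫⁻ x : S.levels, ENNReal.ofReal (klBer (S.h x p) (S.h x u)) ∂m := by
  have h := continuous_parametric_integral_of_continuous (μ := m)
    (f := fun (u : S.abilities) (x : S.levels) => klBer (S.h x p) (S.h x u))
    (continuous_klBer p) isCompact_univ
  simp only [Measure.restrict_univ] at h
  refine (ENNReal.continuous_ofReal.comp h).congr fun u => ?_
  exact ofReal_integral_eq_lintegral_ofReal (integrable_klBer p u m)
    (ae_of_all _ fun x => klBer_nonneg (h_mem_Ioo p x) (h_mem_Ioo u x))

lemma h_le_h (x : S.levels) {u v : S.abilities} (h : u ≤ v) : S.h x u ≤ S.h x v :=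
  (S.h_strictMono x (S.levels_pos x x.2)).monotoneOn (S.ability_pos u) (S.ability_pos v) h

lemma klBer_h_anti_left (x : S.levels) {p u v : S.abilities} (h : u ≤ v) (h' : v ≤ p) :
    klBer (S.h x p) (S.h x v) ≤ klBer (S.h x p) (S.h x u) :=
  klBer_le_klBer_of_ge (h_mem_Ioo p x) (h_mem_Ioo v x) (h_mem_Ioo u x) (h_le_h x h') (h_le_h x h)

lemma klBer_h_mono_right (x : S.levels) {p u v : S.abilities} (h : p ≤ v) (h' : v ≤ u) :
    klBer (S.h x p) (S.h x v) ≤ klBer (S.h x p) (S.h x u) :=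
  klBer_le_klBer_of_le (h_mem_Ioo p x) (h_mem_Ioo v x) (h_mem_Ioo u x) (h_le_h x h) (h_le_h x h')

lemma klBer_h_pos (x : S.levels) {p u : S.abilities} (h : p ≠ u) :
    0 < klBer (S.h x p) (S.h x u) :=
  klBer_pos (h_mem_Ioo p x) (h_mem_Ioo u x) fun e => h <| Subtype.ext <|
    (S.h_strictMono x (S.levels_pos x x.2)).injOn (S.ability_pos p) (S.ability_pos u) e

lemma exists_mem_bracket (u : S.abilities) : ∃ j, (u : ℝ) ∈ S.bracket j := by
  by_contra! hcon
  have h : ∀ k : Fin (S.J + 2), S.u k ≤ ((u : ℝ) : EReal) := fun k => by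
    induction k using Fin.induction with
    | zero => rw [S.u_zero]; exact_mod_cast (S.ability_pos u).le
    | succ j ih => exact not_lt.1 fun h => hcon j ⟨ih, h⟩
  have := h (Fin.last _)
  rw [S.u_last, top_le_iff] at this
  exact EReal.coe_ne_top _ this

lemma isOpen_coe_lt (c : EReal) : IsOpen {v : S.abilities | ((v : ℝ) : EReal) < c} :=
  isOpen_lt (continuous_coe_real_ereal.comp continuous_subtype_val) continuous_const

/-- The lower bound on the number of questions: the occupation measure of a `δ`-correct algorithm, rescaled by
`log (1 / (2.4 δ))`, is feasible. -/
lemma Algorithm.IsDeltaCorrect.mStar_le {A : S.Algorithm} {δ : ℝ}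
    (hA : A.IsDeltaCorrect δ) (hδ : 0 < δ) (hδ' : 2.4 * δ < 1) {i : Fin (S.J + 1)}
    {p : S.abilities} (hp : (p : ℝ) ∈ S.openBracket i) :
    S.mStar i p ≤ A.expectedQuestions p / ENNReal.ofReal (Real.log (1 / (2.4 * δ))) := by
  set c := ENNReal.ofReal (Real.log (1 / (2.4 * δ))) with hc
  have hc0 : c ≠ 0 :=
    (ENNReal.ofReal_pos.2 (Real.log_pos ((one_lt_div (by positivity)).2 hδ'))).ne'
  have hct : c ≠ ⊤ := ENNReal.ofReal_ne_top
  have hfin : IsFiniteMeasure (A.occupation p) :=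
    ⟨by rw [A.occupation_univ]; exact (hA i p hp).1⟩
  have hfeas : S.Feasible i p (c⁻¹ • A.occupation p) := by
    refine ⟨Measure.smul_finite _ (ENNReal.inv_ne_top.2 hc0), le_iInf₂ fun u hu => ?_⟩
    rw [lintegral_smul_measure, smul_eq_mul, mul_comm, ← div_eq_mul_inv,
      ENNReal.le_div_iff_mul_le (.inl hc0) (.inl hct), one_mul]
    let v : S.abilities := ⟨u, hu.1⟩
    obtain ⟨j, hj⟩ := exists_mem_bracket v
    have hji : j ≠ i := fun h => hu.2 (h ▸ hj)
    -- an ability on the boundary of its bracket is a limit of abilities in the open bracket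
    refine ge_of_tendsto (((continuous_lintegral_klBer p (A.occupation p)).tendsto v).mono_left
      (nhdsWithin_le_nhds (s := Ioi v))) ?_
    filter_upwards [self_mem_nhdsWithin,
      nhdsWithin_le_nhds ((isOpen_coe_lt (S.u j.succ)).mem_nhds hj.2)] with v' h1 h2
    have hv' : (v' : ℝ) ∈ S.openBracket j := ⟨hj.1.trans_lt (EReal.coe_lt_coe_iff.2 h1), h2⟩
    rw [A.lintegral_occupation p (continuous_klBer_right p v').measurable.ennreal_ofReal]
    exact hA.ofReal_log_le_tsum hδ hδ' hji hp hv'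
  refine (iInf₂_le _ hfeas).trans_eq ?_
  rw [Measure.smul_apply, A.occupation_univ, smul_eq_mul, mul_comm, div_eq_mul_inv]

/-! ### The variational problem and its dual -/

lemma exists_ability_eq {b : EReal} (h1 : (S.pmin : EReal) < b) (h2 : b < (S.pmax : EReal)) :
    ∃ v : S.abilities, ((v : ℝ) : EReal) = b := by
  induction b using EReal.rec with
  | bot => exact absurd h1 not_lt_bot
  | top => exact absurd h2 not_top_lt
  | coe b => exact ⟨⟨b, EReal.coe_lt_coe_iff.1 h1, EReal.coe_lt_coe_iff.1 h2⟩, rfl⟩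

lemma boundaryDiv_coe (p v : S.abilities) (x : S.levels) :
    S.boundaryDiv p ((v : ℝ) : EReal) x = ENNReal.ofReal (klBer (S.h x p) (S.h x v)) := by
  rw [boundaryDiv, if_pos ⟨EReal.coe_lt_coe_iff.2 v.2.1, EReal.coe_lt_coe_iff.2 v.2.2⟩,
    EReal.toReal_coe]

/-- Among the abilities outside the bracket, the boundaries of the bracket that are interior to the
range of abilities are the hardest to tell from `p`; the lower boundary is only approached. -/
lemma feasible_iff_boundary {i : Fin (S.J + 1)} {p : S.abilities}
    (hp : (p : ℝ) ∈ S.openBracket i) {m : Measure S.levels} [IsFiniteMeasure m] :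
    S.Feasible i p m ↔
      ((S.pmin : EReal) < S.u i.castSucc → 1 ≤ ∫⁻ x, S.f₁ i p x ∂m) ∧
      (S.u i.succ < (S.pmax : EReal) → 1 ≤ ∫⁻ x, S.f₂ i p x ∂m) := by
  have hpmin : (S.pmin : EReal) < ((p : ℝ) : EReal) := EReal.coe_lt_coe_iff.2 p.2.1
  have hpmax : ((p : ℝ) : EReal) < (S.pmax : EReal) := EReal.coe_lt_coe_iff.2 p.2.2
  constructor
  · rintro ⟨-, hm⟩
    have hm' : ∀ u : S.abilities, (u : ℝ) ∉ S.bracket i →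
        1 ≤ ∫⁻ x : S.levels, ENNReal.ofReal (klBer (S.h x p) (S.h x u)) ∂m :=
      fun u hu => hm.trans (iInf₂_le (u : ℝ) ⟨u.2, hu⟩)
    constructor
    · intro h1
      obtain ⟨v, hv⟩ := exists_ability_eq h1 (hp.1.trans hpmax)
      simp only [f₁, ← hv, boundaryDiv_coe]
      refine ge_of_tendsto (((continuous_lintegral_klBer p m).tendsto v).mono_left
        (nhdsWithin_le_nhds (s := Iio v))) ?_
      filter_upwards [self_mem_nhdsWithin] with v' hv'
      exact hm' v' fun h => not_lt.2 h.1 (hv ▸ EReal.coe_lt_coe_iff.2 hv')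
    · intro h2
      obtain ⟨v, hv⟩ := exists_ability_eq (hpmin.trans hp.2) h2
      simp only [f₂, ← hv, boundaryDiv_coe]
      exact hm' v fun h => h.2.ne hv
  · rintro ⟨hm1, hm2⟩
    refine ⟨inferInstance, le_iInf₂ fun u hu => ?_⟩
    obtain ⟨hu, hub⟩ := hu
    rcases lt_or_ge ((u : ℝ) : EReal) (S.u i.castSucc) with h | h
    · have h1 : (S.pmin : EReal) < S.u i.castSucc := (EReal.coe_lt_coe_iff.2 hu.1).trans h
      obtain ⟨v, hv⟩ := exists_ability_eq h1 (hp.1.trans hpmax)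
      have hm := hm1 h1
      simp only [f₁, ← hv, boundaryDiv_coe] at hm
      refine hm.trans (lintegral_mono fun x => ENNReal.ofReal_le_ofReal
        (klBer_h_anti_left x (u := ⟨u, hu⟩) ?_ ?_))
      · rw [← hv] at h; exact (EReal.coe_lt_coe_iff.1 h).le
      · have := hp.1; rw [← hv] at this; exact (EReal.coe_lt_coe_iff.1 this).le
    · have h' : S.u i.succ ≤ ((u : ℝ) : EReal) := not_lt.1 fun h' => hub ⟨h, h'⟩
      have h2 : S.u i.succ < (S.pmax : EReal) := h'.trans_lt (EReal.coe_lt_coe_iff.2 hu.2)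
      obtain ⟨v, hv⟩ := exists_ability_eq (hpmin.trans hp.2) h2
      have hm := hm2 h2
      simp only [f₂, ← hv, boundaryDiv_coe] at hm
      refine hm.trans (lintegral_mono fun x => ENNReal.ofReal_le_ofReal
        (klBer_h_mono_right x (u := ⟨u, hu⟩) ?_ ?_))
      · have := hp.2; rw [← hv] at this; exact (EReal.coe_lt_coe_iff.1 this).le
      · rw [← hv] at h'; exact EReal.coe_le_coe_iff.1 h'

lemma ofReal_mix {w s t : ℝ} (hw : w ∈ Icc (0 : ℝ) 1) (hs : 0 ≤ s) (ht : 0 ≤ t) :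
    ENNReal.ofReal w * ENNReal.ofReal s + ENNReal.ofReal (1 - w) * ENNReal.ofReal t =
      ENNReal.ofReal (w * s + (1 - w) * t) := by
  have hw' : 0 ≤ 1 - w := sub_nonneg.2 hw.2
  rw [← ENNReal.ofReal_mul hw.1, ← ENNReal.ofReal_mul hw',
    ← ENNReal.ofReal_add (mul_nonneg hw.1 hs) (mul_nonneg hw' ht)]

lemma ofReal_add_ofReal_one_sub {w : ℝ} (hw : w ∈ Icc (0 : ℝ) 1) :
    ENNReal.ofReal w + ENNReal.ofReal (1 - w) = 1 := by
  rw [← ENNReal.ofReal_add hw.1 (sub_nonneg.2 hw.2)]; simp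

lemma mix_top {w : ℝ} (hw : w ∈ Icc (0 : ℝ) 1) :
    ENNReal.ofReal w * ⊤ + ENNReal.ofReal (1 - w) * ⊤ = ⊤ := by
  rw [← add_mul, ofReal_add_ofReal_one_sub hw, one_mul]

/-- Strong duality, when the boundary divergences may be replaced by the finite positive payoffs
`g₁`, `g₂` in the constraints, the primal objective and the dual objective. All three optimal
values are read off from one saddle point. -/
lemma duality_of_payoffs {i : Fin (S.J + 1)} {p : S.abilities} {g₁ g₂ : S.levels → ℝ}
    (hg₁ : Continuous g₁) (hg₂ : Continuous g₂) (hpos₁ : ∀ x, 0 < g₁ x) (hpos₂ : ∀ x, 0 < g₂ x)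
    (hfeas : ∀ (m : Measure S.levels) [IsFiniteMeasure m], S.Feasible i p m ↔
      1 ≤ ∫⁻ x, ENNReal.ofReal (g₁ x) ∂m ∧ 1 ≤ ∫⁻ x, ENNReal.ofReal (g₂ x) ∂m)
    (hprimal : ∀ w ∈ Icc (0 : ℝ) 1, ∀ x₁ x₂, S.primalObjective i p w x₁ x₂ =
      ENNReal.ofReal (min (w * g₁ x₁ + (1 - w) * g₁ x₂) (w * g₂ x₁ + (1 - w) * g₂ x₂)))
    (hle₁ : ∀ x, ENNReal.ofReal (g₁ x) ≤ S.f₁ i p x)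
    (hle₂ : ∀ x, ENNReal.ofReal (g₂ x) ≤ S.f₂ i p x)
    (hdual : ∀ l ∈ Icc (0 : ℝ) 1, ∃ l' ∈ Icc (0 : ℝ) 1, ∀ x,
      ENNReal.ofReal l' * S.f₁ i p x + ENNReal.ofReal (1 - l') * S.f₂ i p x ≤
        ENNReal.ofReal (l * g₁ x + (1 - l) * g₂ x)) :
    (∃ V : ℝ≥0∞, IsGreatest {v : ℝ≥0∞ | ∃ w ∈ Icc (0 : ℝ) 1, ∃ x₁ x₂ : S.levels,
        v = S.primalObjective i p w x₁ x₂} V ∧ S.mStar i p = V⁻¹) ∧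
    (∃ (x₁ x₂ : S.levels) (c₁ c₂ : ℝ≥0),
      S.Feasible i p (c₁ • Measure.dirac x₁ + c₂ • Measure.dirac x₂) ∧
        (c₁ : ℝ≥0∞) + c₂ = S.mStar i p) ∧
    S.mStar i p = (S.dualValue i p)⁻¹ := by
  have : Nonempty S.levels := S.levels_nonempty.to_subtype
  obtain ⟨V, w, hw, x₁, x₂, l, hl, hV₁, hV₂, hVl⟩ := exists_saddle hg₁ hg₂
  have hw' : 0 ≤ 1 - w := sub_nonneg.2 hw.2
  have hl' : 0 ≤ 1 - l := sub_nonneg.2 hl.2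
  have hV : 0 < V := by
    refine lt_of_lt_of_le ?_ (hVl x₁)
    rcases hl.1.eq_or_lt with h0 | h0
    · simpa [← h0] using hpos₂ x₁
    · exact add_pos_of_pos_of_nonneg (mul_pos h0 (hpos₁ x₁)) (mul_nonneg hl' (hpos₂ x₁).le)
  have hdirac : ∀ (c₁ c₂ : ℝ≥0) (g : S.levels → ℝ), Continuous g →
      ∫⁻ x, ENNReal.ofReal (g x) ∂(c₁ • Measure.dirac x₁ + c₂ • Measure.dirac x₂) =
        c₁ * ENNReal.ofReal (g x₁) + c₂ * ENNReal.ofReal (g x₂) := fun c₁ c₂ g hg => by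
    rw [lintegral_add_measure, lintegral_smul_measure, lintegral_smul_measure,
      lintegral_dirac' _ hg.measurable.ennreal_ofReal,
      lintegral_dirac' _ hg.measurable.ennreal_ofReal]
    rfl
  -- the optimal mixture, scaled to value `1`
  set c₁ : ℝ≥0 := Real.toNNReal (w / V) with hc₁
  set c₂ : ℝ≥0 := Real.toNNReal ((1 - w) / V) with hc₂
  have hcle : ∀ g : S.levels → ℝ, (∀ x, 0 < g x) → V ≤ w * g x₁ + (1 - w) * g x₂ →
      1 ≤ (c₁ : ℝ≥0∞) * ENNReal.ofReal (g x₁) + c₂ * ENNReal.ofReal (g x₂) := fun g hg h => by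
    have a1 : 0 ≤ w / V := div_nonneg hw.1 hV.le
    have a2 : 0 ≤ (1 - w) / V := div_nonneg hw' hV.le
    change 1 ≤ ENNReal.ofReal _ * _ + ENNReal.ofReal _ * _
    rw [← ENNReal.ofReal_mul a1, ← ENNReal.ofReal_mul a2,
      ← ENNReal.ofReal_add (mul_nonneg a1 (hg _).le) (mul_nonneg a2 (hg _).le),
      ENNReal.one_le_ofReal, ← sub_nonneg]
    have e : w / V * g x₁ + (1 - w) / V * g x₂ - 1 =
        (w * g x₁ + (1 - w) * g x₂ - V) / V := by field_simp
    rw [e]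
    exact div_nonneg (sub_nonneg.2 h) hV.le
  have hmem : S.Feasible i p (c₁ • Measure.dirac x₁ + c₂ • Measure.dirac x₂) := by
    rw [hfeas, hdirac c₁ c₂ g₁ hg₁, hdirac c₁ c₂ g₂ hg₂]
    exact ⟨hcle g₁ hpos₁ hV₁, hcle g₂ hpos₂ hV₂⟩
  have hmass : (c₁ : ℝ≥0∞) + c₂ = (ENNReal.ofReal V)⁻¹ := by
    change ENNReal.ofReal _ + ENNReal.ofReal _ = _
    rw [← ENNReal.ofReal_add (div_nonneg hw.1 hV.le) (div_nonneg hw' hV.le),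
      ← ENNReal.ofReal_inv_of_pos hV]
    congr 1
    field_simp
    ring
  have hstar : S.mStar i p = (ENNReal.ofReal V)⁻¹ := by
    refine le_antisymm ((iInf₂_le _ hmem).trans_eq ?_) (le_iInf₂ fun m hm => ?_)
    · rw [← hmass, Measure.add_apply, Measure.smul_apply, Measure.smul_apply, measure_univ,
        measure_univ]
      simp [ENNReal.smul_def]
    · have := hm.1
      obtain ⟨h1, h2⟩ := (hfeas m).1 hm
      rw [ENNReal.inv_le_iff_le_mul (fun _ => (ENNReal.ofReal_pos.2 hV).ne')
        (fun h => absurd h ENNReal.ofReal_ne_top)]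
      calc (1 : ℝ≥0∞) = ENNReal.ofReal l * 1 + ENNReal.ofReal (1 - l) * 1 := by
            rw [mul_one, mul_one, ofReal_add_ofReal_one_sub hl]
        _ ≤ ENNReal.ofReal l * ∫⁻ x, ENNReal.ofReal (g₁ x) ∂m +
              ENNReal.ofReal (1 - l) * ∫⁻ x, ENNReal.ofReal (g₂ x) ∂m := by gcongr
        _ = ∫⁻ x, ENNReal.ofReal (l * g₁ x + (1 - l) * g₂ x) ∂m := by
            have m1 := hg₁.measurable.ennreal_ofReal
            have m2 := hg₂.measurable.ennreal_ofReal
            rw [← lintegral_const_mul _ m1, ← lintegral_const_mul _ m2,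
              ← lintegral_add_left (m1.const_mul _)]
            exact lintegral_congr fun x => ofReal_mix hl (hpos₁ x).le (hpos₂ x).le
        _ ≤ ∫⁻ _, ENNReal.ofReal V ∂m := lintegral_mono fun x => ENNReal.ofReal_le_ofReal (hVl x)
        _ = ENNReal.ofReal V * m univ := lintegral_const _
  refine ⟨⟨ENNReal.ofReal V, ⟨⟨w, hw, x₁, x₂, ?_⟩, ?_⟩, hstar⟩,
    ⟨x₁, x₂, c₁, c₂, hmem, hmass.trans hstar.symm⟩, ?_⟩
  · rw [hprimal w hw]
    congr 1
    refine le_antisymm (le_min hV₁ hV₂) ?_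
    have h3 : w * (l * g₁ x₁ + (1 - l) * g₂ x₁) + (1 - w) * (l * g₁ x₂ + (1 - l) * g₂ x₂) ≤ V := by
      linarith [mul_le_mul_of_nonneg_left (hVl x₁) hw.1, mul_le_mul_of_nonneg_left (hVl x₂) hw']
    set s := min (w * g₁ x₁ + (1 - w) * g₁ x₂) (w * g₂ x₁ + (1 - w) * g₂ x₂)
    have h4 := mul_le_mul_of_nonneg_left (min_le_left _ _ : s ≤ w * g₁ x₁ + (1 - w) * g₁ x₂) hl.1
    have h5 := mul_le_mul_of_nonneg_left (min_le_right _ _ : s ≤ w * g₂ x₁ + (1 - w) * g₂ x₂) hl'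
    linarith
  · rintro _ ⟨v, hv, y₁, y₂, rfl⟩
    have hv' : 0 ≤ 1 - v := sub_nonneg.2 hv.2
    rw [hprimal v hv]
    refine ENNReal.ofReal_le_ofReal ?_
    have h3 : v * (l * g₁ y₁ + (1 - l) * g₂ y₁) + (1 - v) * (l * g₁ y₂ + (1 - l) * g₂ y₂) ≤ V := by
      linarith [mul_le_mul_of_nonneg_left (hVl y₁) hv.1, mul_le_mul_of_nonneg_left (hVl y₂) hv']
    set s := min (v * g₁ y₁ + (1 - v) * g₁ y₂) (v * g₂ y₁ + (1 - v) * g₂ y₂)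
    have h4 := mul_le_mul_of_nonneg_left (min_le_left _ _ : s ≤ v * g₁ y₁ + (1 - v) * g₁ y₂) hl.1
    have h5 := mul_le_mul_of_nonneg_left (min_le_right _ _ : s ≤ v * g₂ y₁ + (1 - v) * g₂ y₂) hl'
    linarith
  · rw [hstar]
    congr 1
    refine le_antisymm (le_iInf₂ fun k hk => ?_) ?_
    · have hk' : 0 ≤ 1 - k := sub_nonneg.2 hk.2
      -- one of the two points of the optimal mixture does at least as well as their average
      obtain ⟨x, hx⟩ : ∃ x, V ≤ k * g₁ x + (1 - k) * g₂ x := by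
        by_contra! hcon
        have a1 := mul_le_mul_of_nonneg_left hV₁ hk.1
        have a2 := mul_le_mul_of_nonneg_left hV₂ hk'
        have a3 := mul_le_mul_of_nonneg_left (hcon x₁).le hw.1
        have a4 := mul_le_mul_of_nonneg_left (hcon x₂).le hw'
        rcases hw.1.eq_or_lt with h0 | h0
        · have := hcon x₂
          rw [← h0] at a1 a2
          linarith
        · have := mul_lt_mul_of_pos_left (hcon x₁) h0
          linarith
      refine le_trans ?_ (le_iSup _ x)
      refine (ENNReal.ofReal_le_ofReal hx).trans ?_
      rw [← ofReal_mix hk (hpos₁ x).le (hpos₂ x).le]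
      have := hle₁ x
      have := hle₂ x
      gcongr
    · obtain ⟨l', hl'I, h⟩ := hdual l hl
      exact (iInf₂_le l' hl'I).trans (iSup_le fun x =>
        (h x).trans (ENNReal.ofReal_le_ofReal (hVl x)))

/-- The primal formulation, the sufficiency of two levels, and the dual formulation. -/
lemma mStar_strong_duality {i : Fin (S.J + 1)} {p : S.abilities}
    (hp : (p : ℝ) ∈ S.openBracket i) :
    (∃ V : ℝ≥0∞, IsGreatest {v : ℝ≥0∞ | ∃ w ∈ Icc (0 : ℝ) 1, ∃ x₁ x₂ : S.levels,
        v = S.primalObjective i p w x₁ x₂} V ∧ S.mStar i p = V⁻¹) ∧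
    (∃ (x₁ x₂ : S.levels) (c₁ c₂ : ℝ≥0),
      S.Feasible i p (c₁ • Measure.dirac x₁ + c₂ • Measure.dirac x₂) ∧
        (c₁ : ℝ≥0∞) + c₂ = S.mStar i p) ∧
    S.mStar i p = (S.dualValue i p)⁻¹ := by
  have hpmin : (S.pmin : EReal) < ((p : ℝ) : EReal) := EReal.coe_lt_coe_iff.2 p.2.1
  have hpmax : ((p : ℝ) : EReal) < (S.pmax : EReal) := EReal.coe_lt_coe_iff.2 p.2.2
  have h10 : (1 : ℝ) ∈ Icc (0 : ℝ) 1 := ⟨zero_le_one, le_rfl⟩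
  have h00 : (0 : ℝ) ∈ Icc (0 : ℝ) 1 := ⟨le_rfl, zero_le_one⟩
  by_cases h1 : (S.pmin : EReal) < S.u i.castSucc <;> by_cases h2 : S.u i.succ < (S.pmax : EReal)
  · obtain ⟨v₁, hv₁⟩ := exists_ability_eq h1 (hp.1.trans hpmax)
    obtain ⟨v₂, hv₂⟩ := exists_ability_eq (hpmin.trans hp.2) h2
    have hf₁ : ∀ x, S.f₁ i p x = ENNReal.ofReal (klBer (S.h x p) (S.h x v₁)) := fun x => by
      rw [f₁, ← hv₁, boundaryDiv_coe]
    have hf₂ : ∀ x, S.f₂ i p x = ENNReal.ofReal (klBer (S.h x p) (S.h x v₂)) := fun x => by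
      rw [f₂, ← hv₂, boundaryDiv_coe]
    have hne₁ : p ≠ v₁ := fun h => hp.1.ne' (h ▸ hv₁)
    have hne₂ : p ≠ v₂ := fun h => hp.2.ne (h ▸ hv₂)
    have hpos₁ := fun x => klBer_h_pos x hne₁
    have hpos₂ := fun x => klBer_h_pos x hne₂
    refine duality_of_payoffs (continuous_klBer_right p v₁) (continuous_klBer_right p v₂)
      hpos₁ hpos₂ (fun m _ => ?_) (fun w hw x₁ x₂ => ?_) (fun x => (hf₁ x).ge)
      (fun x => (hf₂ x).ge) fun l hl => ⟨l, hl, fun x => ?_⟩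
    · rw [feasible_iff_boundary hp]
      simp only [h1, h2, hf₁, hf₂, forall_const]
    · rw [primalObjective, hf₁, hf₁, hf₂, hf₂, ofReal_mix hw (hpos₁ _).le (hpos₁ _).le,
        ofReal_mix hw (hpos₂ _).le (hpos₂ _).le, ENNReal.ofReal_min]
    · rw [hf₁, hf₂, ofReal_mix hl (hpos₁ _).le (hpos₂ _).le]
  · obtain ⟨v, hv⟩ := exists_ability_eq h1 (hp.1.trans hpmax)
    have hf₁ : ∀ x, S.f₁ i p x = ENNReal.ofReal (klBer (S.h x p) (S.h x v)) := fun x => by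
      rw [f₁, ← hv, boundaryDiv_coe]
    have hf₂ : ∀ x, S.f₂ i p x = ⊤ := fun x => if_neg fun h => h2 h.2
    have hpos := fun x => klBer_h_pos x (fun h => hp.1.ne' (h ▸ hv) : p ≠ v)
    -- the one constraint that is present may be written twice
    refine duality_of_payoffs (continuous_klBer_right p v) (continuous_klBer_right p v)
      hpos hpos (fun m _ => ?_) (fun w hw x₁ x₂ => ?_) (fun x => (hf₁ x).ge)
      (fun x => (hf₂ x).symm ▸ le_top) fun l hl => ⟨1, h10, fun x => ?_⟩
    · rw [feasible_iff_boundary hp]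
      simp only [h1, h2, hf₁, forall_const, IsEmpty.forall_iff, and_true, and_self]
    · rw [primalObjective, hf₁, hf₁, hf₂, hf₂, mix_top hw, min_top_right, min_self,
        ofReal_mix hw (hpos _).le (hpos _).le]
    · rw [hf₁, ← add_mul]; simp
  · obtain ⟨v, hv⟩ := exists_ability_eq (hpmin.trans hp.2) h2
    have hf₂ : ∀ x, S.f₂ i p x = ENNReal.ofReal (klBer (S.h x p) (S.h x v)) := fun x => by
      rw [f₂, ← hv, boundaryDiv_coe]
    have hf₁ : ∀ x, S.f₁ i p x = ⊤ := fun x => if_neg fun h => h1 h.1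
    have hpos := fun x => klBer_h_pos x (fun h => hp.2.ne (h ▸ hv) : p ≠ v)
    refine duality_of_payoffs (continuous_klBer_right p v) (continuous_klBer_right p v)
      hpos hpos (fun m _ => ?_) (fun w hw x₁ x₂ => ?_) (fun x => (hf₁ x).symm ▸ le_top)
      (fun x => (hf₂ x).ge) fun l hl => ⟨0, h00, fun x => ?_⟩
    · rw [feasible_iff_boundary hp]
      simp only [h1, h2, hf₂, forall_const, IsEmpty.forall_iff, true_and, and_self]
    · rw [primalObjective, hf₁, hf₁, hf₂, hf₂, mix_top hw, min_top_left, min_self,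
        ofReal_mix hw (hpos _).le (hpos _).le]
    · rw [hf₂, ← add_mul]; simp
  · -- no admissible ability lies outside the bracket, and the zero measure is feasible
    have hf₁ : ∀ x, S.f₁ i p x = ⊤ := fun x => if_neg fun h => h1 h.1
    have hf₂ : ∀ x, S.f₂ i p x = ⊤ := fun x => if_neg fun h => h2 h.2
    obtain ⟨x₀, hx₀⟩ := S.levels_nonempty
    have hzero : ∀ m : Measure S.levels, [IsFiniteMeasure m] → S.Feasible i p m := fun m _ =>
      (feasible_iff_boundary hp).2 ⟨fun h => absurd h h1, fun h => absurd h h2⟩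
    have hstar : S.mStar i p = 0 :=
      le_antisymm ((iInf₂_le (0 : Measure S.levels) (hzero 0)).trans_eq (by simp)) zero_le
    have hobj : ∀ w ∈ Icc (0 : ℝ) 1, ∀ x₁ x₂, S.primalObjective i p w x₁ x₂ = ⊤ :=
      fun w hw x₁ x₂ => by rw [primalObjective, hf₁, hf₁, hf₂, hf₂, mix_top hw, min_self]
    refine ⟨⟨⊤, ⟨⟨1, h10, ⟨x₀, hx₀⟩, ⟨x₀, hx₀⟩, (hobj 1 h10 _ _).symm⟩, fun _ _ => le_top⟩,
      by rw [hstar, ENNReal.inv_top]⟩, ⟨⟨x₀, hx₀⟩, ⟨x₀, hx₀⟩, 0, 0, hzero _, by simp [hstar]⟩, ?_⟩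
    have hdual : S.dualValue i p = ⊤ := by
      refine top_le_iff.1 (le_iInf₂ fun l hl => ?_)
      refine le_trans ?_ (le_iSup _ (⟨x₀, hx₀⟩ : S.levels))
      rw [hf₁, hf₂, mix_top hl]
    rw [hstar, hdual, ENNReal.inv_top]

end GradingProblem

theorem mainTheorem1 (S : GradingProblem) (i : Fin (S.J + 1)) (p : S.abilities)
    (hp : (p : ℝ) ∈ S.openBracket i) :
    -- the lower bound on the sample complexity of every δ-correct algorithm
    (∀ δ : ℝ, 0 < δ → 2.4 * δ < 1 → ∀ A : S.Algorithm, A.IsDeltaCorrect δ →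
      S.mStar i p ≤ A.expectedQuestions p / ENNReal.ofReal (Real.log (1 / (2.4 * δ)))) ∧
    -- the primal formulation, with an attained maximum
    (∃ V : ℝ≥0∞, IsGreatest {v : ℝ≥0∞ | ∃ w ∈ Icc (0 : ℝ) 1, ∃ x₁ x₂ : S.levels,
        v = S.primalObjective i p w x₁ x₂} V ∧ S.mStar i p = V⁻¹) ∧
    -- questions at no more than two levels suffice
    (∃ (x₁ x₂ : S.levels) (c₁ c₂ : ℝ≥0),
      S.Feasible i p (c₁ • Measure.dirac x₁ + c₂ • Measure.dirac x₂) ∧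
        (c₁ : ℝ≥0∞) + c₂ = S.mStar i p) ∧
    -- the dual formulation
    S.mStar i p = (S.dualValue i p)⁻¹ := by
  exact ⟨fun δ hδ hδ' A hA => hA.mStar_le hδ hδ' hp, GradingProblem.mStar_strong_duality hp⟩
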